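/- Let $\ell\ge 3$ and let $C=(C_{ij})$ be the Cartan matrix of the simple Lie algebra $\mathfrak g$ of type $D_\ell$ (nodes $1,\dots,\ell$; the node $\ell-2$ is joined to $\ell-1$ and to $\ell$; $D_3=A_3$), with simple roots $\alpha_i$, fundamental weights $\omega_i$, $(\alpha_i,\omega_j)=\delta_{ij}$, and $\rho=\sum_i\omega_i$. **Setting.** Let $K=\mathbb C[[h,\beta]]$, $K'=\mathbb C[[h]]((\beta))$, $q^\gamma=e^{h\gamma}\in K$ for $\gamma\in\mathbb C[\beta]$, $q=e^h$, $t=q^\beta$, and $C_{ij}(q,t)=(qt^{-1}+q^{-1}t)\delta_{ij}-(2\delta_{ij}-C_{ij})$. The Heisenberg algebra has generators $x_i[n]$ ($n\ne0$), $q^{\xi y_i[0]}$ ($\xi\in\mathbb C[\beta]$), $e^{\gamma Q_i}$ ($\gamma\in\beta^{-1}\mathbb C[\beta]$), with $[x_i[n],x_j[m]]=n\frac{t^n-t^{-n}}{q^n-q^{-n}}C_{ij}(q^n,t^n)\,\delta_{n,-m}$. It acts faithfully on $\bigoplus_{\mu\in P}\pi_\mu$, $P=\mathbb C[\beta]\otimes\mathfrak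 h^*$, where the Fock module $\pi_\mu$ has as basis the monomials in the $x_i[n]$, $n<0$, applied to $v_\mu$; $x_i[n]v_\mu=0$ for $n>0$; $q^{\xi y_i[0]}$ acts on $\pi_\mu$ as the scalar $q^{\xi(\mu,\omega_i)}$; and $e^{\gamma Q_i}$ commutes with all $x_j[n]$ and sends $v_\mu$ to $v_{\mu+\gamma\beta\alpha_i}$. Put $a_i[n]=\frac{q^n-q^{-n}}{n}x_i[n]$ and define $y_i[n]$ by $a_j[n]=\sum_i C_{ij}(q^n,t^n)\,y_i[n]$. Elements of the (completed) algebra are regarded as operators on $\bigoplus_\mu\pi_\mu$ (or on $K'\otimes_K\bigoplus_\mu\pi_\mu$). For $a\in\mathbb C^*q^{\mathbb Z}t^{\mathbb Z}$ let $Y_i(za)$ be obtained by replacing $z$ by $za$ in $$Y_i(z)=t^{2(\rho,\omega_i)}q^{-2(\rho,\omega_i)+2y_i[0]}\exp\Big(\sum_{m\ne0}y_i[m]z^{-m}\Big).$$ Products of the $Y_i(za)^{\pm1}$ are always normally ordered: the exponential of the terms with $m<0$ stands to the left of that of the terms with $m>0$. Let $\mathbf H_{q,t}(\mathfrak g)$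 be the $K$-span of all normally ordered monomials in the $Y_i(za)^{\pm1}$, as formal series in $z^{\pm1}$. The screening operators $S_i^{+}$ and $S_i^{-}$ are the coefficients of $w^{-1}$ in $$e^{-Q_i}:\!\exp\Big(\sum_{m\neq0}\tfrac{a_i[m]}{q^m-q^{-m}}w^{-m}\Big)\!:,\qquad e^{Q_i/\beta}:\!\exp\Big(-\sum_{m\neq0}\tfrac{a_i[m]}{t^m-t^{-m}}w^{-m}\Big)\!:,$$ seen as maps from $\pi_0$ to $\pi_{-\beta\alpha_i}$, and from $\pi_0$ to $K'\otimes_K\pi_{\alpha_i}$. Let $\mathbf W_{q,t}(\mathfrak g)$ be the space of those $\Phi(z)=\sum_n\Phi_nz^n\in\mathbf H_{q,t}(\mathfrak g)$ such that $\Phi_nS_i^\pm=S_i^\pm\Phi_n$ on $\pi_0$ for all $n\in\mathbb Z$ and all $i\in\{1,\dots,\ell\}$. **The fields.** Write $Y_0=1$. For $1\le i\le\ell-2$ put $$\Lambda_i(z)=Y_i(zq^{-i+1}t^{i-1})Y_{i-1}(zq^{-i}t^i)^{-1},\qquad \Lambda_{\bar i}(z)=Y_{i-1}(zq^{-2\ell+i+2}t^{2\ell-i-2})Y_i(zq^{-2\ell+i+1}t^{2\ell-i-1})^{-1},$$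 and $$\Lambda_{\ell-1}(z)=Y_\ell(zq^{-\ell+2}t^{\ell-2})Y_{\ell-1}(zq^{-\ell+2}t^{\ell-2})Y_{\ell-2}(zq^{-\ell+1}t^{\ell-1})^{-1},\qquad \Lambda_\ell(z)=Y_\ell(zq^{-\ell+2}t^{\ell-2})Y_{\ell-1}(zq^{-\ell}t^\ell)^{-1},$$ $$\Lambda_{\bar\ell}(z)=Y_{\ell-1}(zq^{-\ell+2}t^{\ell-2})Y_\ell(zq^{-\ell}t^\ell)^{-1},\qquad \Lambda_{\overline{\ell-1}}(z)=Y_{\ell-2}(zq^{-\ell+1}t^{\ell-1})Y_{\ell-1}(zq^{-\ell}t^\ell)^{-1}Y_\ell(zq^{-\ell}t^\ell)^{-1}.$$ Let $T_1(z)=\sum_{i=1}^{\ell}\big(\Lambda_i(z)+\Lambda_{\bar i}(z)\big)$. For $\varepsilon=\pm$ let $Y_+=Y_\ell$, $Y_-=Y_{\ell-1}$, $T_+=T_\ell$, $T_-=T_{\ell-1}$, where $$T_\varepsilon(z)=\sum_{\sigma_1,\dots,\sigma_{\ell-1}=\pm1}b_{\sigma_1}(z|1)\,b_{\sigma_2}(zq^{-\sigma_1}t^{\sigma_1}|2)\cdots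 b^{\varepsilon(-\sigma_1)\cdots(-\sigma_{\ell-2})}_{\sigma_{\ell-1}}(zq^{-\sigma_1-\cdots-\sigma_{\ell-2}}t^{\sigma_1+\cdots+\sigma_{\ell-2}}|\ell-1),$$ with $b_1(z|k)=1$ and $b_{-1}(z|k)=Y_{k-1}(zq^{-\ell+1}t^{\ell-1})^{-1}Y_k(zq^{-\ell+2}t^{\ell-2})$ for $1\le k\le\ell-2$, and $$b_1^\varepsilon(z|\ell-1)=Y_\varepsilon(zq^{-\ell}t^\ell)^{-1},\qquad b_{-1}^\varepsilon(z|\ell-1)=Y_{\ell-2}(zq^{-\ell+1}t^{\ell-1})^{-1}Y_\varepsilon(zq^{-\ell+2}t^{\ell-2}).$$ **Proposition.** For all $i\in\{1,\ell-1,\ell\}$, the field $T_i(z)$ belongs to $\mathbf W_{q,t}(\mathfrak g)$. -/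

import Mathlib

/-!
The deformed `W`-algebra `W_{q,t}(g)` for a simply laced Cartan matrix, over `ℂ⟦h, β⟧`, realised
on Fock modules, and the fields `T_1`, `T_{ℓ-1}`, `T_ℓ` in type `D_ℓ`.

In the simply laced case `r = 1` and `r_i = 1` for every node `i`, so that `D(q,t)` is the identity
matrix and `B(q,t) = C(q,t)`.
-/

open scoped Polynomial

namespace DeformedW

noncomputable section

/-! ### Scalars -/

/-- The ring `K = ℂ⟦h, β⟧ = ℂ⟦h⟧⟦β⟧` (inner variable `h`, outer variable `β`). -/
abbrev K : Type := PowerSeries (PowerSeries ℂ)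

/-- The ring `K' = ℂ⟦h⟧((β))`. -/
def K' : Type := LaurentSeries (PowerSeries ℂ)

instance : CommRing K' := inferInstanceAs (CommRing (LaurentSeries (PowerSeries ℂ)))

instance : Algebra K K' :=
  inferInstanceAs (Algebra (PowerSeries (PowerSeries ℂ)) (LaurentSeries (PowerSeries ℂ)))

instance : IsLocalization (Submonoid.powers (PowerSeries.X : K)) K' :=
  inferInstanceAs (IsLocalization (Submonoid.powers (PowerSeries.X : PowerSeries (PowerSeries ℂ)))
    (LaurentSeries (PowerSeries ℂ)))

/-- The element `h` of `K`. -/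
def h : K := PowerSeries.C PowerSeries.X

/-- A complex number as an element of `K`. -/
def cst (c : ℂ) : K := PowerSeries.C (PowerSeries.C c)

/-- For `γ ∈ ℂ[β]`, the power `q ^ γ = exp (h γ) ∈ K`; its coefficient at `h ^ k β ^ j` is the
coefficient of `γ ^ k / k!` at `β ^ j`. In particular `q = q ^ 1` and `t = q ^ β`. -/
def qpow (γ : ℂ[X]) : K :=
  PowerSeries.mk fun j => PowerSeries.mk fun k => (γ ^ k).coeff j / (k.factorial : ℂ)

/-- The polynomial `m + n β`, so that `qpow (expo m n) = q ^ m * t ^ n`. -/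
def expo (m n : ℤ) : ℂ[X] := Polynomial.C (m : ℂ) + Polynomial.C (n : ℂ) * Polynomial.X

/-- The element `(q ^ γ - q ^ (-γ)) / h` of `K`; see `h_mul_qdiff`. -/
def qdiff (γ : ℂ[X]) : K :=
  PowerSeries.mk fun j => PowerSeries.mk fun k =>
    ((γ ^ (k + 1)).coeff j - ((-γ) ^ (k + 1)).coeff j) / ((k + 1).factorial : ℂ)

theorem h_mul_qdiff (γ : ℂ[X]) : h * qdiff γ = qpow γ - qpow (-γ) := by
  ext j k
  simp only [h, qdiff, qpow, PowerSeries.coeff_C_mul, PowerSeries.coeff_mk, map_sub]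
  cases k with
  | zero => simp [PowerSeries.coeff_zero_X_mul]
  | succ k => rw [PowerSeries.coeff_succ_X_mul, PowerSeries.coeff_mk]; ring

/-- `(t ^ n - t ^ (-n)) / (q ^ n - q ^ (-n)) ∈ K`, for `n ≠ 0`; see `tqRatio_mul`. -/
def tqRatio (n : ℤ) : K := qdiff (expo 0 n) * Ring.inverse (qdiff (expo n 0))

theorem isUnit_qdiff {n : ℤ} (hn : n ≠ 0) : IsUnit (qdiff (expo n 0)) := by
  rw [PowerSeries.isUnit_iff_constantCoeff, PowerSeries.isUnit_iff_constantCoeff,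
    isUnit_iff_ne_zero, ← PowerSeries.coeff_zero_eq_constantCoeff_apply,
    ← PowerSeries.coeff_zero_eq_constantCoeff_apply]
  simp only [qdiff, expo, PowerSeries.coeff_mk]
  have : (n : ℂ) ≠ 0 := by exact_mod_cast hn
  simpa [← two_mul] using this

theorem tqRatio_mul {n : ℤ} (hn : n ≠ 0) :
    tqRatio n * (qpow (expo n 0) - qpow (-expo n 0)) = qpow (expo 0 n) - qpow (-expo 0 n) := by
  rw [← h_mul_qdiff, ← h_mul_qdiff, tqRatio, mul_comm h (qdiff (expo n 0)), mul_assoc,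
    Ring.inverse_mul_cancel_left _ _ (isUnit_qdiff hn), mul_comm]

/-- `(q ^ n - q ^ (-n)) / (t ^ n - t ^ (-n)) ∈ K'`, for `n ≠ 0`; see `qtRatio_mul`. -/
def qtRatio (n : ℤ) : K' :=
  algebraMap K K' (qdiff (expo n 0)) * Ring.inverse (algebraMap K K' (qdiff (expo 0 n)))

theorem isUnit_algebraMap_qdiff {n : ℤ} (hn : n ≠ 0) :
    IsUnit (algebraMap K K' (qdiff (expo 0 n))) := by
  have key : qdiff (expo 0 n) = PowerSeries.X *
      (PowerSeries.mk fun j => PowerSeries.mk fun k =>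
        (((expo 0 n) ^ (k + 1)).coeff (j + 1) - ((-expo 0 n) ^ (k + 1)).coeff (j + 1)) /
          ((k + 1).factorial : ℂ)) := by
    ext j k
    cases j with
    | zero =>
      simp [qdiff, expo, Polynomial.coeff_zero_eq_eval_zero]
    | succ j => simp [qdiff, PowerSeries.coeff_succ_X_mul]
  rw [key, map_mul]
  refine IsUnit.mul
    (IsLocalization.map_units K' 
      (⟨PowerSeries.X, 1, pow_one _⟩ : Submonoid.powers (PowerSeries.X : K)))
    (IsUnit.map _ ?_)
  rw [PowerSeries.isUnit_iff_constantCoeff, PowerSeries.isUnit_iff_constantCoeff,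
    isUnit_iff_ne_zero, ← PowerSeries.coeff_zero_eq_constantCoeff_apply,
    ← PowerSeries.coeff_zero_eq_constantCoeff_apply]
  have : (n : ℂ) ≠ 0 := by exact_mod_cast hn
  simpa [expo, ← two_mul] using this

theorem qtRatio_mul {n : ℤ} (hn : n ≠ 0) :
    qtRatio n * algebraMap K K' (qpow (expo 0 n) - qpow (-expo 0 n)) =
      algebraMap K K' (qpow (expo n 0) - qpow (-expo n 0)) := by
  rw [← h_mul_qdiff, ← h_mul_qdiff, qtRatio, mul_comm h (qdiff (expo 0 n)), map_mul, mul_assoc,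
    Ring.inverse_mul_cancel_left _ _ (isUnit_algebraMap_qdiff hn), ← map_mul, mul_comm]

variable {ℓ : ℕ}

/-- The deformed Cartan matrix `C(q ^ n, t ^ n)` with entries
`(q ^ n t ^ (-n) + q ^ (-n) t ^ n) δ_{ij} - (2 δ_{ij} - C_{ij})`. -/
def cartanQT (C : Matrix (Fin ℓ) (Fin ℓ) ℤ) (n : ℤ) : Matrix (Fin ℓ) (Fin ℓ) K :=
  Matrix.of fun i j =>
    (if i = j then qpow (expo n (-n)) + qpow (expo (-n) n) else 0) -
      (((if i = j then 2 else 0) - C i j : ℤ) : K)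

/-! ### Fock modules and the Heisenberg algebra -/

/-- The space `P = ℂ[β] ⊗ 𝔥*`, in coordinates with respect to the simple roots: `μ` stands for
`∑ i, μ i • α_i`, so that `(μ, ω_i) = μ i`. -/
abbrev Wt (ℓ : ℕ) : Type := Fin ℓ → ℂ[X]

/-- The Fock module `π_μ` with scalars extended to `K'`: it has the basis of the monomials in
`x_i[-n]` (`n > 0`) applied to `v_μ`; the variable `(i, n)` stands for `x_i[-n]`
and `1` for `v_μ`. -/
abbrev Fock (ℓ : ℕ) : Type := MvPolynomial (Fin ℓ × ℕ+) K'

/-- The direct sum `⨁_{μ ∈ P} π_μ`, with scalars extended to `K'`. The (completed) Heisenberg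
algebra acts faithfully on it, and its elements are regarded as operators on it. -/
abbrev FockSum (ℓ : ℕ) : Type := Wt ℓ →₀ Fock ℓ

/-- The algebra of operators on `⨁_{μ ∈ P} π_μ`. -/
abbrev Op (ℓ : ℕ) : Type := Module.End K' (FockSum ℓ)

/-- The action of `x_i[n]`, `n ≠ 0`, on a Fock module: multiplication by the variable for `n < 0`,
and for `n > 0` the operator killing `v_μ` with
`[x_i[n], x_j[-m]] = n (t^n - t^(-n)) / (q^n - q^(-n)) B_{ij}(q^n, t^n) δ_{n,m}`. -/
def xFock (C : Matrix (Fin ℓ) (Fin ℓ) ℤ) (i : Fin ℓ) (n : ℤ) : Module.End K' (Fock ℓ) :=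
  if n < 0 then LinearMap.mulLeft K' (MvPolynomial.X (i, n.natAbs.toPNat'))
  else if 0 < n then
    ∑ j, ((n : K) * tqRatio n * cartanQT C n i j) •
      (MvPolynomial.pderiv (j, n.natAbs.toPNat')).toLinearMap
  else 0

/-- The operator `x_i[n]` on `⨁ π_μ`. -/
def x (C : Matrix (Fin ℓ) (Fin ℓ) ℤ) (i : Fin ℓ) (n : ℤ) : Op ℓ :=
  Finsupp.mapRange.linearMap (xFock C i n)

/-- The operator `a_i[n] = (q ^ n - q ^ (-n)) / n • x_i[n]`. -/
def a (C : Matrix (Fin ℓ) (Fin ℓ) ℤ) (i : Fin ℓ) (n : ℤ) : Op ℓ :=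
  (cst ((n : ℂ)⁻¹) * (qpow (expo n 0) - qpow (-expo n 0))) • x C i n

/-- The operators `y_i[n]`, determined by `a_j[n] = ∑ i, C_{ij}(q ^ n, t ^ n) y_i[n]`. -/
def y (C : Matrix (Fin ℓ) (Fin ℓ) ℤ) (i : Fin ℓ) (n : ℤ) : Op ℓ :=
  ∑ j, (cartanQT C n)⁻¹ j i • a C j n

/-- The operator `∏ i, q ^ (ξ_i y_i[0])`, with `q ^ (ξ y_i[0]) v_μ = q ^ (ξ (μ, ω_i)) v_μ`. -/
def qy0 (ξ : Fin ℓ → ℂ[X]) : Op ℓ :=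
  Finsupp.lsum K' fun μ => qpow (∑ i, ξ i * μ i) • Finsupp.lsingle μ

/-- The shift operator `exp (γ Q_i)`, where `δ = γ β ∈ ℂ[β]`; it commutes with the `x_j[n]`
and sends `v_μ` to `v_{μ + δ α_i}`. -/
def expQ (i : Fin ℓ) (δ : ℂ[X]) : Op ℓ :=
  Finsupp.lmapDomain (Fock ℓ) K' fun μ => μ + Pi.single i δ

/-! ### Normally ordered exponentials -/

open Classical in
/-- The pointwise sum of a family of operators that is locally finite, i.e. such that every vector
is killed by all but finitely many of its members. -/
def locSum (T : ℕ → Op ℓ) : Op ℓ :=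
  if H : ∀ v, (Function.support fun r => T r v).Finite then
    { toFun := fun v => ∑ᶠ r, T r v
      map_add' := fun u v => by
        simp only [map_add]
        exact finsum_add_distrib (H u) (H v)
      map_smul' := fun c v => by
        simp only [map_smul, RingHom.id_apply]
        exact (smul_finsum' c (H v)).symm }
  else 0

/-- The coefficient at `w ^ p` of `exp (∑ m > 0, c m w ^ m) = ∑ k, (∑ m > 0, c m w ^ m) ^ k / k!`
(only the terms with `k ≤ p` contribute). -/
def expCoeff (c : ℕ → Op ℓ) (p : ℕ) : Op ℓ :=
  ∑ k ∈ Finset.range (p + 1), cst ((k.factorial : ℂ)⁻¹) •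
    PowerSeries.coeff p ((PowerSeries.mk fun m => if m = 0 then 0 else c m) ^ k)

/-- The coefficient at `z ^ n` of the normally ordered exponential
`:exp (∑ m ≠ 0, c m z ^ (-m)): = exp (∑ m < 0, c m z ^ (-m)) exp (∑ m > 0, c m z ^ (-m))`. -/
def normExp (c : ℤ → Op ℓ) (n : ℤ) : Op ℓ :=
  locSum fun r =>
    if 0 ≤ n + r then expCoeff (fun m => c (-m)) (n + r).toNat * expCoeff (fun m => c m) r else 0

/-! ### Monomials in the `Y_i(z a)` -/

/-- Spectral parameters: `(c, m, n)` stands for `c q ^ m t ^ n ∈ ℂˣ q ^ ℤ t ^ ℤ`. -/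
abbrev Spec : Type := ℂˣ × ℤ × ℤ

/-- The element `s ^ k` of `K`, for a spectral parameter `s`. -/
def Spec.zpow (s : Spec) (k : ℤ) : K :=
  cst ((s.1 ^ k : ℂˣ) : ℂ) * qpow (expo (k * s.2.1) (k * s.2.2))

/-- Monomials `:∏ Y_i(z a) ^ {d_{i,a}}:`, given by their exponents `d_{i,a}`.
The normally ordered product of monomials corresponds to the sum of exponents. -/
abbrev Mono (ℓ : ℕ) : Type := (Fin ℓ × Spec) →₀ ℤ

/-- The number `(ρ, ω_i) = (ρ^∨, ω_i)`. -/
def rhoOmega (C : Matrix (Fin ℓ) (Fin ℓ) ℤ) (i : Fin ℓ) : ℂ :=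
  ∑ j, (C.map (Int.cast : ℤ → ℂ))⁻¹ i j

/-- The coefficient at `z ^ n` of `:∏ Y_i(z a) ^ {d_{i,a}}:`, where
`Y_i(z) = t ^ (2 (ρ^∨, ω_i)) q ^ (-2 (ρ, ω_i) + 2 y_i[0]) exp (∑ m ≠ 0, y_i[m] z ^ (-m))`. -/
def monoField (C : Matrix (Fin ℓ) (Fin ℓ) ℤ) (d : Mono ℓ) (n : ℤ) : Op ℓ :=
  qpow (d.sum fun p e =>
      Polynomial.C (e * (2 * rhoOmega C p.1)) * (Polynomial.X - 1)) •
    (qy0 (fun i => d.sum fun p e => if p.1 = i then Polynomial.C (2 * (e : ℂ)) else 0) *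
      normExp (fun m => d.sum fun p e => ((e : K) * p.2.zpow (-m)) • y C p.1 m) n)

/-! ### The screening operators and the deformed `W`-algebra -/

/-- The screening operator `S_i^+`: the coefficient at `w ^ (-1)` of
`exp (-Q_i) :exp (∑ m ≠ 0, s_i^+[m] w ^ (-m)):`, with
`s_i^+[m] = a_i[m] / (q ^ m - q ^ (-m)) = x_i[m] / m`. -/
def screenPlus (C : Matrix (Fin ℓ) (Fin ℓ) ℤ) (i : Fin ℓ) : Op ℓ :=
  expQ i (-Polynomial.X) * normExp (fun m => cst ((m : ℂ)⁻¹) • x C i m) (-1)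

/-- The screening operator `S_i^-`: the coefficient at `w ^ (-1)` of
`exp (Q_i / β) :exp (-∑ m ≠ 0, s_i^-[m] w ^ (-m)):`, with
`s_i^-[m] = a_i[m] / (t ^ m - t ^ (-m)) = (q ^ m - q ^ (-m)) / (m (t ^ m - t ^ (-m))) • x_i[m]`. -/
def screenMinus (C : Matrix (Fin ℓ) (Fin ℓ) ℤ) (i : Fin ℓ) : Op ℓ :=
  expQ i 1 * normExp (fun m => (-qtRatio m) • (cst ((m : ℂ)⁻¹) • x C i m)) (-1)

/-- The `K`-module `H_{q,t}(g)` spanned by the monomials in the `Y_i(z a)`. -/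
def HField (C : Matrix (Fin ℓ) (Fin ℓ) ℤ) : Submodule K (ℤ → Op ℓ) :=
  Submodule.span K (Set.range (monoField C))

/-- A field commutes with a screening operator `S`, seen as a map from `π_0` to some `π_μ`. -/
def CommutesOnVacuum (Φ : ℤ → Op ℓ) (S : Op ℓ) : Prop :=
  ∀ (n : ℤ) (v : Fock ℓ), Φ n (S (Finsupp.single 0 v)) = S (Φ n (Finsupp.single 0 v))

/-- The deformed `W`-algebra `W_{q,t}(g)`: the fields in `H_{q,t}(g)` that commute with all the
screening operators. -/
def WField (C : Matrix (Fin ℓ) (Fin ℓ) ℤ) : Submodule K (ℤ → Op ℓ) where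
  carrier := {Φ | Φ ∈ HField C ∧
    ∀ i, CommutesOnVacuum Φ (screenPlus C i) ∧ CommutesOnVacuum Φ (screenMinus C i)}
  add_mem' := by
    rintro Φ Ψ ⟨h1, h2⟩ ⟨h3, h4⟩
    refine ⟨add_mem h1 h3, fun i => ⟨fun n v => ?_, fun n v => ?_⟩⟩
    · simp [(h2 i).1 n v, (h4 i).1 n v]
    · simp [(h2 i).2 n v, (h4 i).2 n v]
  zero_mem' := ⟨zero_mem _, fun i => ⟨fun n v => by simp, fun n v => by simp⟩⟩
  smul_mem' := by
    rintro c Φ ⟨h1, h2⟩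
    refine ⟨Submodule.smul_mem _ c h1, fun i => ⟨fun n v => ?_, fun n v => ?_⟩⟩
    · simp only [Pi.smul_apply, LinearMap.smul_apply, (h2 i).1 n v]
      exact (LinearMap.map_smul_of_tower _ c _).symm
    · simp only [Pi.smul_apply, LinearMap.smul_apply, (h2 i).2 n v]
      exact (LinearMap.map_smul_of_tower _ c _).symm

/-! ### Local finiteness

The sums defining `normExp` are locally finite for all the families of modes used above. -/

/-- Vectors all of whose monomials `∏ x_{i}[-n]^{d(i,n)}` have degree `∑ n d(i,n) < N`. -/
def lowDeg (ℓ N : ℕ) : Submodule K' (FockSum ℓ) where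
  carrier := {v | ∀ μ d, MvPolynomial.coeff d (v μ) ≠ 0 → (d.sum fun p e => e * (p.2 : ℕ)) < N}
  add_mem' := by
    intro u v hu hv μ d hd
    by_cases h0 : MvPolynomial.coeff d (u μ) = 0
    · exact hv μ d fun h1 => hd (by simp [h0, h1])
    · exact hu μ d h0
  zero_mem' := by intro μ d hd; simp at hd
  smul_mem' := by
    intro c v hv μ d hd
    exact hv μ d fun h1 => hd (by simp [h1])

theorem lowDeg_zero (v : FockSum ℓ) (hv : v ∈ lowDeg ℓ 0) : v = 0 := by
  ext μ d
  by_contra h1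
  exact absurd (hv μ d (by simpa using h1)) (by simp)

theorem exists_lowDeg (v : FockSum ℓ) : ∃ N, v ∈ lowDeg ℓ N := by
  classical
  refine ⟨(v.support.sup fun μ => (v μ).support.sup fun d => d.sum fun p e => e * (p.2 : ℕ)) + 1,
    fun μ d hd => Nat.lt_succ_of_le ?_⟩
  have h1 : μ ∈ v.support := by
    rw [Finsupp.mem_support_iff]; rintro h0; simp [h0] at hd
  exact (Finset.le_sup (f := fun d : (Fin ℓ × ℕ+) →₀ ℕ => d.sum fun p e => e * (p.2 : ℕ))
    (MvPolynomial.mem_support_iff.2 hd)).trans (Finset.le_sup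
      (f := fun μ => (v μ).support.sup fun d => d.sum fun p e => e * (p.2 : ℕ)) h1)

/-- Operators lowering degrees by at least `m`. -/
def Lowers (m : ℕ) (S : Op ℓ) : Prop := ∀ N, ∀ v ∈ lowDeg ℓ N, S v ∈ lowDeg ℓ (N - m)

theorem lowers_x (C : Matrix (Fin ℓ) (Fin ℓ) ℤ) (i : Fin ℓ) {m : ℕ} (hm : 0 < m) :
    Lowers m (x C i m) := by
  intro N v hv μ d hd
  have hm' : ¬ ((m : ℤ) < 0) := by omega
  have hm2 : (0 : ℤ) < m := by omega
  simp only [x, xFock, Finsupp.mapRange.linearMap_apply, Finsupp.mapRange_apply, if_neg hm',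
    if_pos hm2, LinearMap.sum_apply, LinearMap.smul_apply, MvPolynomial.coeff_sum] at hd
  obtain ⟨j, -, hj⟩ := Finset.exists_ne_zero_of_sum_ne_zero hd
  rw [MvPolynomial.coeff_smul] at hj
  have h2 : MvPolynomial.coeff d (MvPolynomial.pderiv (j, m.toPNat') (v μ)) ≠ 0 := by
    intro h0; apply hj; simp [h0]
  rw [MvPolynomial.coeff_pderiv] at h2
  have h3 := hv μ _ (left_ne_zero_of_mul h2)
  rw [Finsupp.sum_add_index' (by simp) (by intros; ring), Finsupp.sum_single_index (by simp)] at h3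
  simp [Nat.toPNat'_coe, hm] at h3
  omega

theorem Lowers.smulK {m : ℕ} {S : Op ℓ} (hS : Lowers m S) (c : K) : Lowers m (c • S) := by
  intro N v hv
  have : (c • S) v = (algebraMap K K' c) • S v := by
    rw [LinearMap.smul_apply, algebraMap_smul]
  rw [this]
  exact Submodule.smul_mem _ _ (hS N v hv)

theorem Lowers.smulK' {m : ℕ} {S : Op ℓ} (hS : Lowers m S) (c : K') : Lowers m (c • S) :=
  fun N v hv => Submodule.smul_mem _ _ (hS N v hv)

theorem Lowers.add {m : ℕ} {S T : Op ℓ} (hS : Lowers m S) (hT : Lowers m T) : Lowers m (S + T) :=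
  fun N v hv => add_mem (hS N v hv) (hT N v hv)

theorem lowers_zero {m : ℕ} : Lowers m (0 : Op ℓ) := fun _ _ _ => zero_mem _

theorem Lowers.sum {ι : Type*} {m : ℕ} {s : Finset ι} {S : ι → Op ℓ}
    (hS : ∀ i ∈ s, Lowers m (S i)) : Lowers m (∑ i ∈ s, S i) := by
  intro N v hv
  rw [LinearMap.sum_apply]
  exact sum_mem fun i hi => hS i hi N v hv

theorem Lowers.mul {m n : ℕ} {S T : Op ℓ} (hS : Lowers m S) (hT : Lowers n T) :
    Lowers (n + m) (S * T) := by
  intro N v hv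
  rw [← Nat.sub_sub]
  exact hS _ _ (hT _ _ hv)

theorem lowers_pow {c : ℕ → Op ℓ} (hc : ∀ m, 0 < m → Lowers m (c m)) (k : ℕ) : ∀ p,
    Lowers p (PowerSeries.coeff p ((PowerSeries.mk fun m => if m = 0 then 0 else c m) ^ k)) := by
  induction k with
  | zero =>
    intro p
    rw [pow_zero, PowerSeries.coeff_one]
    split_ifs with h
    · subst h; intro N v hv; simpa using hv
    · exact lowers_zero
  | succ k ih =>
    intro p
    rw [pow_succ, PowerSeries.coeff_mul]
    refine Lowers.sum fun ij hij => ?_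
    rw [← Finset.HasAntidiagonal.mem_antidiagonal.1 hij, add_comm]
    refine Lowers.mul (ih _) ?_
    rw [PowerSeries.coeff_mk]
    split_ifs with h
    · exact lowers_zero
    · exact hc _ (Nat.pos_of_ne_zero h)

theorem lowers_expCoeff {c : ℕ → Op ℓ} (hc : ∀ m, 0 < m → Lowers m (c m)) (p : ℕ) :
    Lowers p (expCoeff c p) :=
  Lowers.sum fun k _ => (lowers_pow hc k p).smulK _

theorem normExp_apply {c : ℤ → Op ℓ} (hc : ∀ m : ℕ, 0 < m → Lowers m (c m)) (n : ℤ)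
    (v : FockSum ℓ) : normExp c n v = ∑ᶠ r : ℕ, (if 0 ≤ n + r then
      expCoeff (fun m => c (-m)) (n + r).toNat (expCoeff (fun m => c m) r v) else 0) := by
  have H : ∀ v, (Function.support fun r : ℕ => (if 0 ≤ n + r then
      expCoeff (fun m => c (-m)) (n + r).toNat * expCoeff (fun m => c m) r else 0 : Op ℓ) v).Finite := by
    intro v
    obtain ⟨N, hN⟩ := exists_lowDeg v
    refine (Set.finite_lt_nat N).subset fun r hr => ?_
    by_contra h1
    simp only [Set.mem_ofPred_eq, not_lt] at h1
    have := lowers_expCoeff hc r N v hN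
    rw [Nat.sub_eq_zero_of_le h1] at this
    apply hr
    dsimp only
    split_ifs
    · rw [Module.End.mul_apply, lowDeg_zero _ this, map_zero]
    · rfl
  rw [normExp, locSum, dif_pos H]
  refine finsum_congr fun r => ?_
  split_ifs <;> rfl

theorem lowers_y (C : Matrix (Fin ℓ) (Fin ℓ) ℤ) (i : Fin ℓ) {m : ℕ} (hm : 0 < m) :
    Lowers m (y C i m) :=
  Lowers.sum fun _ _ => ((lowers_x C _ hm).smulK _).smulK _

theorem lowers_mono (C : Matrix (Fin ℓ) (Fin ℓ) ℤ) (d : Mono ℓ) {m : ℕ} (hm : 0 < m) :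
    Lowers m (d.sum fun p e => ((e : K) * p.2.zpow (-m)) • y C p.1 m) := by
  refine Lowers.sum fun p _ => ?_
  exact (lowers_y C _ hm).smulK _

theorem lowers_screenPlus (C : Matrix (Fin ℓ) (Fin ℓ) ℤ) (i : Fin ℓ) {m : ℕ} (hm : 0 < m) :
    Lowers m (cst (((m : ℤ) : ℂ)⁻¹) • x C i m) :=
  (lowers_x C _ hm).smulK _

theorem lowers_screenMinus (C : Matrix (Fin ℓ) (Fin ℓ) ℤ) (i : Fin ℓ) {m : ℕ} (hm : 0 < m) :
    Lowers m ((-qtRatio m) • (cst (((m : ℤ) : ℂ)⁻¹) • x C i m)) :=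
  ((lowers_x C _ hm).smulK _).smulK' _

/-! ### The fields `T_1`, `T_{ℓ-1}`, `T_ℓ` in type `D_ℓ` -/

/-- The monomial `Y_i(z q ^ k t ^ (-k))`, with nodes numbered `1, …, ℓ` as usual (node `i` is the
element `i - 1` of `Fin ℓ`), and the convention that `Y_0 = 1`. -/
def Y (ℓ i : ℕ) (k : ℤ) : Mono ℓ :=
  if H : 1 ≤ i ∧ i ≤ ℓ then
    Finsupp.single ((⟨i - 1, by omega⟩ : Fin ℓ), ((1, k, -k) : Spec)) 1
  else 0

/-- The monomial `Λ_i(z)`, for `1 ≤ i ≤ ℓ`. -/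
def Lam (ℓ i : ℕ) : Mono ℓ :=
  if i + 2 ≤ ℓ then Y ℓ i (-i + 1) - Y ℓ (i - 1) (-i)
  else if i + 1 = ℓ then Y ℓ ℓ (-ℓ + 2) + Y ℓ (ℓ - 1) (-ℓ + 2) - Y ℓ (ℓ - 2) (-ℓ + 1)
  else Y ℓ ℓ (-ℓ + 2) - Y ℓ (ℓ - 1) (-ℓ)

/-- The monomial `Λ_{ī}(z)`, for `1 ≤ i ≤ ℓ`. -/
def LamBar (ℓ i : ℕ) : Mono ℓ :=
  if i + 2 ≤ ℓ then Y ℓ (i - 1) (-2 * ℓ + i + 2) - Y ℓ i (-2 * ℓ + i + 1)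
  else if i + 1 = ℓ then Y ℓ (ℓ - 2) (-ℓ + 1) - Y ℓ (ℓ - 1) (-ℓ) - Y ℓ ℓ (-ℓ)
  else Y ℓ (ℓ - 1) (-ℓ + 2) - Y ℓ ℓ (-ℓ)

/-- The field `T_1(z) = ∑_{i = 1}^{ℓ} (Λ_i(z) + Λ_{ī}(z))`. -/
def vectorField (ℓ : ℕ) : ℤ → Op ℓ :=
  ∑ i ∈ Finset.Icc 1 ℓ,
    (monoField (CartanMatrix.D ℓ) (Lam ℓ i) + monoField (CartanMatrix.D ℓ) (LamBar ℓ i))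

/-- The node attached to a sign: `ℓ` for `+`, and `ℓ - 1` for `-`. -/
def spinNode (ℓ : ℕ) (ε : ℤˣ) : ℕ := if ε = 1 then ℓ else ℓ - 1

/-- The monomial `b_s(z q ^ k t ^ (-k) | j)` for `1 ≤ j ≤ ℓ - 2`, and
`b_s^ε(z q ^ k t ^ (-k) | ℓ - 1)` for `j = ℓ - 1`. -/
def b (ℓ : ℕ) (ε s : ℤˣ) (k : ℤ) (j : ℕ) : Mono ℓ :=
  if j + 1 = ℓ then
    if s = 1 then -Y ℓ (spinNode ℓ ε) (k - ℓ)
    else Y ℓ (spinNode ℓ ε) (k - ℓ + 2) - Y ℓ (ℓ - 2) (k - ℓ + 1)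
  else
    if s = 1 then 0
    else Y ℓ j (k - ℓ + 2) - Y ℓ (j - 1) (k - ℓ + 1)

/-- The monomial of the sign vector `(σ_1, …, σ_{ℓ-1})`: the product over `j = 1, …, ℓ - 1` of the
`b_{σ_j}(z q ^ (-σ_1 - ⋯ - σ_{j-1}) t ^ (σ_1 + ⋯ + σ_{j-1}) | j)`, where the last factor carries the
superscript `ε (-σ_1) ⋯ (-σ_{ℓ-2})`. -/
def spinMono (ℓ : ℕ) (ε : ℤˣ) (σ : Fin (ℓ - 1) → ℤˣ) : Mono ℓ :=
  ∑ j : Fin (ℓ - 1),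
    b ℓ (ε * ∏ i ∈ Finset.Iio j, -σ i) (σ j) (-∑ i ∈ Finset.Iio j, (σ i : ℤ)) ((j : ℕ) + 1)

/-- The spinor field `T_ε(z)`: `T_ℓ(z)` for `ε = +` and `T_{ℓ-1}(z)` for `ε = -`. -/
def spinField (ℓ : ℕ) (ε : ℤˣ) : ℤ → Op ℓ :=
  ∑ σ : Fin (ℓ - 1) → ℤˣ, monoField (CartanMatrix.D ℓ) (spinMono ℓ ε σ)

/-- The field `T_i(z)`, for `i ∈ {1, ℓ - 1, ℓ}`. -/
def T (ℓ i : ℕ) : ℤ → Op ℓ :=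
  if i = 1 then vectorField ℓ
  else if i = ℓ then spinField ℓ 1
  else spinField ℓ (-1)

end

end DeformedW

namespace DeformedW

/-! ### Exponential sequences -/

theorem sum_range_shift {M : Type*} [AddCommMonoid M] (F : ℤ → M) (m N : ℕ)
    (h0 : ∀ z < (m : ℤ), F z = 0) (h1 : ∀ z : ℤ, N ≤ z → F z = 0) :
    ∑ k ∈ Finset.range N, F (k + m) = ∑ k ∈ Finset.range N, F k := by
  have e1 := Finset.sum_range_add (fun k : ℕ => F k) m N
  have e2 := Finset.sum_range_add (fun k : ℕ => F k) N m
  rw [Finset.sum_eq_zero (s := Finset.range m) (fun k hk => h0 _ (by simpa using hk)), zero_add,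
    add_comm m N] at e1
  rw [Finset.sum_eq_zero (s := Finset.range m) (fun k _ => h1 _ (by simp)), add_zero] at e2
  rw [← e2, e1]
  refine Finset.sum_congr rfl fun k _ => ?_
  congr 1
  push_cast
  ring

theorem sum_range_add_comm {M : Type*} [AddCommMonoid M] (f g : ℕ → ℕ → M) (N : ℕ) :
    ∑ m ∈ Finset.range N, (∑ k ∈ Finset.range N, f m k + ∑ k ∈ Finset.range N, g m k) =
      ∑ k ∈ Finset.range N, (∑ m ∈ Finset.range N, f m k + ∑ m ∈ Finset.range N, g m k) := by
  simp only [Finset.sum_add_distrib]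
  rw [Finset.sum_comm, Finset.sum_comm (f := g)]

/-- The sequence `E`, extended by zero to negative indices, of the coefficients of
`exp (∑ m > 0, c m w ^ m)`. -/
structure IsExp {R : Type*} [Ring R] (c : ℕ → R) (E : ℤ → R) : Prop where
  neg : ∀ z < 0, E z = 0
  zero : E 0 = 1
  step : ∀ (r : ℤ) (N : ℕ), r < N →
    r • E r = ∑ m ∈ Finset.range N, (m : ℤ) • (c m * E (r - m))

namespace IsExp

variable {R : Type*} [Ring R] {F : Type*} [CommRing F] [Algebra F R]

theorem scale {c : ℕ → R} {E : ℤ → R} (hE : IsExp c E) (τ : Fˣ) :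
    IsExp (fun m => ((τ ^ (m : ℤ) : Fˣ) : F) • c m) (fun z => ((τ ^ z : Fˣ) : F) • E z) where
  neg z hz := by simp [hE.neg z hz]
  zero := by simp [hE.zero]
  step r N hN := by
    rw [smul_comm, hE.step r N hN, Finset.smul_sum]
    refine Finset.sum_congr rfl fun m _ => ?_
    rw [smul_mul_smul_comm, ← Units.val_mul, ← zpow_add, add_sub_cancel, smul_comm]

variable [IsAddTorsionFree R]

theorem induction {p : ℤ → Prop} (neg : ∀ z < 0, p z) (zero : p 0)
    (step : ∀ r, 0 < r → (∀ z < r, p z) → p r) (r : ℤ) : p r := by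
  have key : ∀ n : ℕ, ∀ z : ℤ, z < n → p z := by
    intro n
    induction n with
    | zero => exact fun z hz => neg z (by simpa using hz)
    | succ n ih =>
      intro z hz
      rcases lt_trichotomy z 0 with h | h | h
      · exact neg z h
      · exact h ▸ zero
      · exact step z h fun z' hz' => ih z' (by push_cast at hz; omega)
  exact key (r.toNat + 1) r (by omega)

theorem ad {a : R} {c : ℕ → R} {E : ℤ → R} (hE : IsExp c E) {m₀ : ℕ} (hm₀ : 0 < m₀) {γ : F}
    (h : ∀ n, a * c n = c n * a + if n = m₀ then γ • 1 else 0) (p : ℤ) :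
    a * E p = E p * a + γ • E (p - m₀) := by
  induction p using induction with
  | neg z hz => rw [hE.neg z hz, hE.neg _ (by omega)]; simp
  | zero => rw [hE.zero, hE.neg _ (by omega)]; simp
  | step p hp ih =>
    refine zsmul_right_injective hp.ne' ?_
    simp only
    obtain ⟨N, hN⟩ : ∃ N : ℕ, N = p.toNat + m₀ + 1 := ⟨_, rfl⟩
    have e : ∀ m ∈ Finset.range N, a * ((m : ℤ) • (c m * E (p - m))) =
        ((m : ℤ) • (c m * E (p - m))) * a + γ • ((m : ℤ) • (c m * E (p - m₀ - m))) +
          if m = m₀ then (m : ℤ) • γ • E (p - m) else 0 := by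
      intro m _
      rcases Nat.eq_zero_or_pos m with rfl | hm
      · simp
      · rw [mul_smul_comm, ← mul_assoc, h, add_mul, mul_assoc (c m), ih _ (by omega), mul_add,
          sub_right_comm p]
        split_ifs
        · simp only [mul_smul_comm, smul_mul_assoc, one_mul, mul_assoc]; module
        · simp only [mul_smul_comm, smul_mul_assoc, zero_mul, mul_assoc]; module
    rw [← mul_smul_comm, hE.step p N (by omega), Finset.mul_sum, Finset.sum_congr rfl e,
      Finset.sum_add_distrib, Finset.sum_add_distrib, ← Finset.sum_mul, ← Finset.smul_sum,
      ← hE.step p N (by omega), ← hE.step _ N (by omega), Finset.sum_ite_eq',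
      if_pos (Finset.mem_range.2 (by omega)), smul_add, smul_mul_assoc]
    module

theorem commute {a : R} {c : ℕ → R} {E : ℤ → R} (hE : IsExp c E) (h : ∀ n, Commute a (c n))
    (p : ℤ) : Commute a (E p) := by
  have := ad (F := ℤ) hE one_pos (γ := 0) (a := a) (by intro n; simpa using (h n).eq) p
  exact (by simpa using this : a * E p = E p * a)

theorem commute₂ {c c' : ℕ → R} {E E' : ℤ → R} (hE : IsExp c E) (hE' : IsExp c' E')
    (h : ∀ m n, Commute (c m) (c' n)) (p r : ℤ) : Commute (E p) (E' r) :=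
  hE'.commute (fun n => (hE.commute (fun m => (h m n).symm) p).symm) r

theorem exchange {a b : ℕ → R} {γ : ℕ → F} {A B : ℤ → R} {G : ℤ → F} (hA : IsExp a A)
    (hB : IsExp b B) (hG : IsExp γ G)
    (h : ∀ m n, a m * b n = b n * a m + if n = m then γ m • 1 else 0) (r p : ℤ) (N : ℕ)
    (hN : r < N) :
    A r * B p = ∑ k ∈ Finset.range N, G k • (B (p - k) * A (r - k)) := by
  induction r using induction with
  | neg z hz =>
    rw [hA.neg z hz, zero_mul, Finset.sum_eq_zero]
    intro k _
    rw [hA.neg _ (by omega)]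
    simp
  | zero =>
    rw [Finset.sum_eq_single_of_mem 0 (Finset.mem_range.2 (by omega))]
    · simp [hA.zero, hG.zero]
    · intro k _ hk
      rw [hA.neg _ (by omega)]
      simp
  | step r hr ih =>
    refine zsmul_right_injective hr.ne' ?_
    simp only
    have e : ∀ m ∈ Finset.range N, ((m : ℤ) • (a m * A (r - m))) * B p =
        (∑ k ∈ Finset.range N, G k • (B (p - k) * ((m : ℤ) • (a m * A (r - k - m))))) +
        ∑ k ∈ Finset.range N, ((m : ℤ) • (γ m * G (k - m))) • (B (p - k) * A (r - k)) := by
      intro m _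
      rcases Nat.eq_zero_or_pos m with rfl | hm
      · simp
      · rw [← sum_range_shift (fun z => ((m : ℤ) • (γ m * G (z - m))) • (B (p - z) * A
          (r - z))) m N,
          smul_mul_assoc, mul_assoc, ih _ (by omega) (by omega), Finset.mul_sum, Finset.smul_sum,
          ← Finset.sum_add_distrib]
        · refine Finset.sum_congr rfl fun k _ => ?_
          rw [mul_smul_comm, ← mul_assoc, hB.ad hm (h m), add_sub_cancel_right, add_mul,
            mul_assoc, sub_right_comm r, smul_mul_assoc, ← sub_sub p, ← sub_sub r, mul_smul_comm,
            sub_right_comm p, sub_right_comm r]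
          simp only [natCast_zsmul]
          module
        · intro z hz
          rw [hG.neg _ (by omega)]; simp
        · intro z hz
          rw [hA.neg (r - z) (by omega)]; simp
    rw [← smul_mul_assoc, hA.step r N hN, Finset.sum_mul, Finset.sum_congr rfl e,
      sum_range_add_comm, Finset.smul_sum]
    refine Finset.sum_congr rfl fun k hk => ?_
    rw [← Finset.smul_sum, ← Finset.mul_sum, ← Finset.sum_smul, ← hG.step k N (by simpa using hk),
      ← hA.step _ N (by omega), mul_smul_comm, sub_smul, natCast_zsmul, natCast_zsmul]
    module

theorem add_apply {c c' : ℕ → R} {E E' H : ℤ → R} (hE : IsExp c E) (hE' : IsExp c' E')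
    (hH : IsExp (fun m => c m + c' m) H) (h : ∀ m n, Commute (c' m) (c n)) (p : ℤ) (N : ℕ)
    (hN : p < N) : H p = ∑ j ∈ Finset.range N, E (p - j) * E' j := by
  induction p using induction with
  | neg z hz =>
    rw [hH.neg z hz, Finset.sum_eq_zero]
    intro k _
    rw [hE.neg _ (by omega), zero_mul]
  | zero =>
    rw [Finset.sum_eq_single_of_mem 0 (Finset.mem_range.2 (by omega))]
    · simp [hE.zero, hE'.zero, hH.zero]
    · intro k _ hk
      rw [hE.neg _ (by omega), zero_mul]
  | step p hp ih =>
    refine zsmul_right_injective hp.ne' ?_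
    simp only
    have e : ∀ m ∈ Finset.range N, (m : ℤ) • ((c m + c' m) * H (p - m)) =
        (∑ j ∈ Finset.range N, ((m : ℤ) • (c m * E (p - j - m))) * E' j) +
        ∑ j ∈ Finset.range N, E (p - j) * ((m : ℤ) • (c' m * E' (j - m))) := by
      intro m _
      rcases Nat.eq_zero_or_pos m with rfl | hm
      · simp
      · rw [← sum_range_shift (fun z => E (p - z) * ((m : ℤ) • (c' m * E' (z - m)))) m N,
          ih _ (by omega) (by omega), Finset.mul_sum, Finset.smul_sum, ← Finset.sum_add_distrib]
        · refine Finset.sum_congr rfl fun k _ => ?_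
          rw [add_mul, ← mul_assoc (c' m), (hE.commute (h m) _).eq, add_sub_cancel_right,
            ← sub_sub p, sub_right_comm p, smul_add, smul_mul_assoc, mul_smul_comm, mul_assoc,
            mul_assoc]
        · intro z hz
          rw [hE'.neg _ (by omega)]; simp
        · intro z hz
          rw [hE.neg (p - z) (by omega)]; simp
    rw [hH.step p N hN, Finset.sum_congr rfl e, sum_range_add_comm, Finset.smul_sum]
    refine Finset.sum_congr rfl fun k hk => ?_
    rw [← Finset.sum_mul, ← Finset.mul_sum, ← hE.step _ N (by omega),
      ← hE'.step k N (by simpa using hk), mul_smul_comm, smul_mul_assoc]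
    module

theorem ratio [IsAddTorsionFree F] {γ : ℕ → F} {G : ℤ → F} (hG : IsExp γ G) (P Q : F)
    (h : ∀ m : ℕ, m • γ m = P ^ m - Q ^ m) (k : ℕ) :
    G (k + 1) = P ^ k * (P - Q) := by
  induction k using Nat.strong_induction_on with
  | _ k ih =>
    refine zsmul_right_injective (n := (k : ℤ) + 1) (by omega) ?_
    simp only
    have e : ∀ m ∈ Finset.range k, ((m + 1 : ℕ) : ℤ) • (γ (m + 1) * G (k + 1 - (m + 1 : ℕ))) =
        P ^ k * (P - Q) - Q * (Q ^ m * P ^ (k - 1 - m)) * (P - Q) := by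
      intro m hm
      have hm := Finset.mem_range.1 hm
      have e1 : ((k : ℤ) + 1 - (m + 1 : ℕ)) = ((k - 1 - m : ℕ) : ℤ) + 1 := by omega
      rw [natCast_zsmul, ← smul_mul_assoc, h, e1, ih _ (by omega)]
      have e2 : P ^ k = P ^ (m + 1) * P ^ (k - 1 - m) := by rw [← pow_add]; congr 1; omega
      rw [e2]; ring
    have e3 : (∑ i ∈ Finset.range k, Q ^ i * P ^ (k - 1 - i)) * (P - Q) = P ^ k - Q ^ k := by
      linear_combination -(Commute.all Q P).geom_sum₂_mul k
    rw [hG.step (k + 1) (k + 2) (by push_cast; omega), Finset.sum_range_succ',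
      Finset.sum_range_succ, Finset.sum_congr rfl e, Finset.sum_sub_distrib, Finset.sum_const,
      Finset.card_range, ← Finset.sum_mul, ← Finset.mul_sum, mul_assoc Q, e3, natCast_zsmul,
      ← smul_mul_assoc (k + 1) (γ (k + 1)), h]
    simp only [Nat.cast_add, Nat.cast_one, sub_self, hG.zero, CharP.cast_eq_zero, zero_smul]
    simp only [nsmul_eq_mul, zsmul_eq_mul]
    push_cast
    ring

end IsExp

theorem sum_range_bilateral {M : Type*} [AddCommGroup M] (φ : ℤ → M) {L ρ : ℕ} (hρ : ρ < L)
    (h0 : ∀ z : ℤ, z < 1 - ρ → φ z = 0) (h1 : ∀ z : ℤ, L ≤ z → φ z = 0) :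
    ∑ k ∈ Finset.range L, φ k + ∑ k ∈ Finset.range L, φ (-k) - φ 0 =
      ∑ j ∈ Finset.range (2 * L - 1), φ (j + 1 - ρ) := by
  have e := sum_range_shift (fun z => φ (z - (L - 1))) (L - ρ) (2 * L - 1)
    (fun z hz => h0 _ (by omega)) (fun z hz => h1 _ (by omega))
  have e1 : ∀ j ∈ Finset.range (2 * L - 1), φ (j + 1 - ρ) = φ (j + (L - ρ : ℕ) - (L - 1)) := by
    intro j _
    congr 1
    omega
  obtain ⟨l, rfl⟩ : ∃ l, L = l + 1 := ⟨L - 1, by omega⟩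
  have e2 : ∑ k ∈ Finset.range (l + (l + 1)), φ (k - ((l + 1 : ℕ) - 1)) =
      ∑ j ∈ Finset.range l, φ (-(j + 1 : ℕ)) + ∑ k ∈ Finset.range (l + 1), φ k := by
    rw [Finset.sum_range_add, ← Finset.sum_range_reflect]
    congr 1 <;> refine Finset.sum_congr rfl fun k hk => ?_ <;> congr 1 <;>
      have := Finset.mem_range.1 hk <;> omega
  rw [Finset.sum_congr rfl e1, e, show 2 * (l + 1) - 1 = l + (l + 1) by omega, e2,
    Finset.sum_range_succ' (fun k : ℕ => φ (-k))]
  simp only [CharP.cast_eq_zero, neg_zero]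
  abel

section

variable {F W : Type*} [CommRing F] [IsAddTorsionFree F] [AddCommGroup W] [Module F W]
  [IsAddTorsionFree (Module.End F W)]

/-- The product of two normally ordered exponentials in both orders, for a rational contraction with
a simple pole. -/
theorem normOrd_commutator {c v : ℤ → Module.End F W} {Cm Cp Vm Vp Hm Hp : ℤ → Module.End F W}
    (P Q : Fˣ) {γ γ' : ℕ → F}
    (hCm : IsExp (fun m => c (-m)) Cm) (hCp : IsExp (fun m => c m) Cp)
    (hVm : IsExp (fun m => v (-m)) Vm) (hVp : IsExp (fun m => v m) Vp)
    (hHm : IsExp (fun m => c (-m) + ((P ^ (m : ℤ) : Fˣ) : F) • v (-m)) Hm)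
    (hHp : IsExp (fun m => c m + ((P ^ (-m : ℤ) : Fˣ) : F) • v m) Hp)
    {G G' : ℤ → F} (hG : IsExp γ G) (hG' : IsExp γ' G')
    (hγ : ∀ m : ℕ, m • γ m = (P : F) ^ m - (Q : F) ^ m)
    (hγ' : ∀ m : ℕ, m • γ' m = ((P⁻¹ : Fˣ) : F) ^ m - ((Q⁻¹ : Fˣ) : F) ^ m)
    (h1 : ∀ m n : ℕ, v m * c (-n) = c (-n) * v m + if n = m then γ m • 1 else 0)
    (h2 : ∀ m n : ℕ, c m * v (-n) = v (-n) * c m + if n = m then γ' m • 1 else 0)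
    (h3 : ∀ m n : ℕ, Commute (v (-m)) (c (-n))) (h4 : ∀ m n : ℕ, Commute (v m) (c n))
    (w : W) (N : ℕ) (hN : ∀ r r' : ℤ, N ≤ r + r' → Cp r' (Vp r w) = 0) (n : ℤ) (L : ℕ)
    (hL : 2 * N + n.natAbs + 2 ≤ L) :
    ∑ r ∈ Finset.range L, ∑ r' ∈ Finset.range L, Vm (r - 1) (Vp r (Cm (n + r') (Cp r' w))) -
      ((Q * P⁻¹ : Fˣ) : F) •
        ∑ r ∈ Finset.range L, ∑ r' ∈ Finset.range L, Cm (n + r') (Cp r' (Vm (r - 1) (Vp r w))) =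
    (((1 - (Q * P⁻¹ : Fˣ)) * P : F)) • ∑ r ∈ Finset.range L, Hm (n - 1 + r) (Hp r w) := by
  have sum_end : ∀ (s : Finset ℕ) (f : ℕ → Module.End F W) (x : W), (∑ i ∈ s, f i) x =
    ∑ i ∈ s, f i x := fun s f x => LinearMap.sum_apply _ _ _
  have c1 : ∀ p r, Cp p * Vp r = Vp r * Cp p :=
    fun p r => (hCp.commute₂ hVp (fun m n => (h4 n m).symm) p r)
  have c2 : ∀ p r, Cm p * Vm r = Vm r * Cm p :=
    fun p r => (hCm.commute₂ hVm (fun m n => (h3 n m).symm) p r)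
  obtain ⟨f, hf⟩ : ∃ f : ℤ → ℤ → ℤ → ℤ → W, ∀ i j r' r, f i j r' r = Cm i (Vm j (Cp r' (Vp r w))) :=
    ⟨_, fun _ _ _ _ => rfl⟩
  have f1 : ∀ i j r' r, i < 0 → f i j r' r = 0 := by
    intro i j r' r hi; rw [hf, hCm.neg i hi]; rfl
  have f2 : ∀ i j r' r, j < 0 → f i j r' r = 0 := by
    intro i j r' r hi; rw [hf, hVm.neg j hi]; simp
  have f3 : ∀ i j r' r, r' < 0 → f i j r' r = 0 := by
    intro i j r' r hi; rw [hf, hCp.neg r' hi]; simp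
  have f4 : ∀ i j r' r, r < 0 → f i j r' r = 0 := by
    intro i j r' r hi; rw [hf, hVp.neg r hi]; simp
  have f5 : ∀ i j r' r : ℤ, N ≤ r + r' → f i j r' r = 0 := by
    intro i j r' r hi; rw [hf, hN r r' hi]; simp
  have t1 : ∑ r ∈ Finset.range L, ∑ r' ∈ Finset.range L, Vm (r - 1) (Vp r (Cm (n + r') (Cp r' w))) =
      ∑ r ∈ Finset.range L, ∑ r' ∈ Finset.range L, ∑ k ∈ Finset.range L,
        G k • f (n + r' - k) (r + k - 1) r' r := by
    have e : ∀ r ∈ Finset.range L, ∀ r' : ℕ, Vm (r - 1) (Vp r (Cm (n + r') (Cp r' w))) =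
        ∑ k ∈ Finset.range L, G k • f (n + r' - k) (r - 1) r' (r - k) := by
      intro r hr r'
      rw [← Module.End.mul_apply (Vp r), hVp.exchange hCm hG h1 r (n + r') L (by simpa using hr),
        sum_end, map_sum]
      refine Finset.sum_congr rfl fun k _ => ?_
      rw [LinearMap.smul_apply, map_smul, hf, ← Module.End.mul_apply (Vm _), ← mul_assoc, ← c2,
        mul_assoc, Module.End.mul_apply, Module.End.mul_apply, ← Module.End.mul_apply (Vp _), ← c1]
      rfl
    rw [Finset.sum_congr rfl fun r hr => Finset.sum_congr rfl fun r' _ => e r hr r',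
        Finset.sum_comm,
      Finset.sum_comm (f := fun r r' : ℕ => ∑ k ∈ Finset.range L,
        G k • f (n + r' - k) (r + k - 1) r' r)]
    refine Finset.sum_congr rfl fun r' _ => ?_
    rw [Finset.sum_comm, Finset.sum_comm (f := fun r k : ℕ => G k • f (n + r' - k)
        (r + k - 1) r' r)]
    refine Finset.sum_congr rfl fun k _ => ?_
    rw [← sum_range_shift (fun z => G k • f (n + r' - k) (z - 1) r' (z - k)) k L]
    · simp only [add_sub_cancel_right]
    · intro z hz
      rw [f4 _ _ _ _ (by omega), smul_zero]
    · intro z hz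
      by_cases h : (n + r' - k : ℤ) < 0
      · rw [f1 _ _ _ _ h, smul_zero]
      · rw [f5 _ _ _ _ (by omega), smul_zero]
  have t2 : ∑ r ∈ Finset.range L, ∑ r' ∈ Finset.range L, Cm (n + r') (Cp r' (Vm (r - 1) (Vp r w))) =
      ∑ r ∈ Finset.range L, ∑ r' ∈ Finset.range L, ∑ k ∈ Finset.range L,
        G' k • f (n + r' + k) (r - 1 - k) r' r := by
    refine Finset.sum_congr rfl fun r hr => ?_
    have e : ∀ r' ∈ Finset.range L, Cm (n + r') (Cp r' (Vm (r - 1) (Vp r w))) =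
        ∑ k ∈ Finset.range L, G' k • f (n + r') (r - 1 - k) (r' - k) r := by
      intro r' hr'
      rw [← Module.End.mul_apply (Cp r'),
        hCp.exchange hVm hG' h2 r' (r - 1) L (by simpa using hr'), sum_end, map_sum]
      refine Finset.sum_congr rfl fun k _ => ?_
      rw [LinearMap.smul_apply, map_smul, hf]
      rfl
    rw [Finset.sum_congr rfl e, Finset.sum_comm,
      Finset.sum_comm (f := fun r' k : ℕ => G' k • f (n + r' + k) (r - 1 - k) r' r)]
    refine Finset.sum_congr rfl fun k _ => ?_
    rw [← sum_range_shift (fun z => G' k • f (n + z) (r - 1 - k) (z - k) r) k L]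
    · simp only [add_sub_cancel_right, add_assoc]
    · intro z hz
      rw [f3 _ _ _ _ (by omega), smul_zero]
    · intro z hz
      by_cases h : (r - 1 - k : ℤ) < 0
      · rw [f2 _ _ _ _ h, smul_zero]
      · rw [f5 _ _ _ _ (by omega), smul_zero]
  have t3 : ∑ r ∈ Finset.range L, Hm (n - 1 + r) (Hp r w) =
      ∑ r ∈ Finset.range L, ∑ r' ∈ Finset.range L, ∑ j ∈ Finset.range (2 * L - 1),
        ((P ^ (j - r : ℤ) : Fˣ) : F) • f (n - 1 + (r' + r) - j) j r' r := by
    have hVp' : IsExp (fun m => ((P ^ (-m : ℤ) : Fˣ) : F) • v m)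
        (fun z => ((P ^ (-z) : Fˣ) : F) • Vp z) := by simpa using hVp.scale P⁻¹
    have e : ∀ R ∈ Finset.range L, Hm (n - 1 + R) (Hp R w) =
        ∑ r ∈ Finset.range L, ∑ j ∈ Finset.range (2 * L - 1),
          ((P ^ (j - r : ℤ) : Fˣ) : F) • f (n - 1 + R - j) j (R - r) r := by
      intro R hR
      have hR' := Finset.mem_range.1 hR
      rw [hCp.add_apply hVp' hHp (fun m n => (h4 m n).smul_left _) R L (by simpa using hR), sum_end,
        map_sum]
      refine Finset.sum_congr rfl fun r _ => ?_
      rw [hCm.add_apply (hVm.scale P) hHm (fun m n => (h3 m n).smul_left _) (n - 1 + R) (2 * L - 1)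
        (by omega), sum_end]
      refine Finset.sum_congr rfl fun j _ => ?_
      rw [hf, sub_eq_add_neg (j : ℤ), zpow_add, Units.val_mul, mul_smul]
      simp only [Module.End.mul_apply, LinearMap.smul_apply, map_smul]
      rw [smul_comm]
    rw [Finset.sum_congr rfl e, Finset.sum_comm]
    refine Finset.sum_congr rfl fun r _ => ?_
    rw [← sum_range_shift (fun z => ∑ j ∈ Finset.range (2 * L - 1),
      ((P ^ (j - r : ℤ) : Fˣ) : F) • f (n - 1 + z - j) j (z - r) r) r L]
    · simp only [add_sub_cancel_right]
    · intro z hz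
      refine Finset.sum_eq_zero fun j _ => ?_
      rw [f3 _ _ _ _ (by omega), smul_zero]
    · intro z hz
      refine Finset.sum_eq_zero fun j _ => ?_
      rw [f5 _ _ _ _ (by omega), smul_zero]
  rw [t1, t2, t3, Finset.smul_sum, Finset.smul_sum, ← Finset.sum_sub_distrib]
  refine Finset.sum_congr rfl fun r hr => ?_
  rw [Finset.smul_sum, Finset.smul_sum, ← Finset.sum_sub_distrib]
  refine Finset.sum_congr rfl fun r' hr' => ?_
  have hr := Finset.mem_range.1 hr
  have hr' := Finset.mem_range.1 hr'
  obtain ⟨φ, hφ⟩ : ∃ φ : ℤ → W, ∀ z, φ z = ((P ^ z : Fˣ) : F) • f (n + r' - z) (r + z - 1) r' r :=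
    ⟨_, fun _ => rfl⟩
  have key := sum_range_bilateral φ hr
    (fun z hz => by rw [hφ, f2 _ _ _ _ (by omega), smul_zero])
    (fun z hz => by
      rw [hφ]
      by_cases h : (n + r' - z : ℤ) < 0
      · rw [f1 _ _ _ _ h, smul_zero]
      · rw [f5 _ _ _ _ (by omega), smul_zero])
  have hP : (P : F) * ((P⁻¹ : Fˣ) : F) = 1 := P.mul_inv
  have hQ : (Q : F) * ((Q⁻¹ : Fˣ) : F) = 1 := Q.mul_inv
  have s1 : ∀ k ∈ Finset.range L, G k • f (n + r' - k) (r + k - 1) r' r =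
      (1 - ((Q * P⁻¹ : Fˣ) : F)) • φ k +
        if k = 0 then ((Q * P⁻¹ : Fˣ) : F) • φ 0 else 0 := by
    rintro (_ | k) _
    · rw [hφ, hφ]
      simp only [CharP.cast_eq_zero, hG.zero, if_pos, zpow_zero, Units.val_one]
      module
    · rw [if_neg (by omega), hφ, smul_smul, add_zero]
      congr 1
      have := hG.ratio _ _ hγ k
      push_cast at this ⊢
      rw [this, zpow_add_one, zpow_natCast]
      push_cast
      linear_combination (Q : F) * (P : F) ^ k * hP
  have s2 : ∀ k ∈ Finset.range L, ((Q * P⁻¹ : Fˣ) : F) • G' k • f (n + r' + k) (r - 1 - k) r' r =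
      -((1 - ((Q * P⁻¹ : Fˣ) : F)) • φ (-k)) + if k = 0 then φ 0 else 0 := by
    rintro (_ | k) _
    · rw [hφ, hφ]
      simp only [CharP.cast_eq_zero, hG'.zero, if_pos, zpow_zero, Units.val_one, neg_zero, sub_zero,
        add_zero]
      module
    · rw [if_neg (by omega), hφ, smul_smul, smul_smul, add_zero, ← neg_smul, sub_neg_eq_add,
        show (r - 1 - (k + 1 : ℕ) : ℤ) = r + -(k + 1 : ℕ) - 1 by ring]
      congr 1
      have := hG'.ratio _ _ hγ' k
      push_cast at this ⊢
      rw [this, zpow_neg, ← inv_zpow, zpow_add_one, zpow_natCast]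
      push_cast
      linear_combination (-((P⁻¹ : Fˣ) : F) ^ (k + 1)) * hQ
  have s3 : ∀ j ∈ Finset.range (2 * L - 1), ((1 - ((Q * P⁻¹ : Fˣ) : F)) * (P : F)) •
      ((P ^ (j - r : ℤ) : Fˣ) : F) • f (n - 1 + (r' + r) - j) j r' r =
      (1 - ((Q * P⁻¹ : Fˣ) : F)) • φ (j + 1 - r) := by
    intro j _
    rw [hφ, mul_smul, smul_smul (P : F), ← Units.val_mul, ← zpow_one_add]
    rw [show (1 + (j - r) : ℤ) = j + 1 - r by ring,
      show n - 1 + (r' + r) - j = n + r' - (j + 1 - r) by ring,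
      show (r + (j + 1 - r) - 1 : ℤ) = j by ring]
  rw [Finset.smul_sum, Finset.smul_sum, Finset.sum_congr rfl s1, Finset.sum_congr rfl s2,
    Finset.sum_congr rfl s3, ← Finset.smul_sum, ← key, Finset.sum_add_distrib,
    Finset.sum_add_distrib, Finset.sum_ite_eq', Finset.sum_ite_eq',
    if_pos (Finset.mem_range.2 (by omega)), if_pos (Finset.mem_range.2 (by omega)),
    Finset.sum_neg_distrib, ← Finset.smul_sum, ← Finset.smul_sum]
  module

end

noncomputable section

variable {ℓ : ℕ}

/-! ### Scalars -/

theorem cst_one : cst 1 = 1 := by simp [cst]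

theorem cst_mul (c d : ℂ) : cst (c * d) = cst c * cst d := by simp [cst]

theorem cst_zero : cst 0 = 0 := by simp [cst]

theorem cst_neg (c : ℂ) : cst (-c) = -cst c := by simp [cst]

theorem cst_natCast (n : ℕ) : cst n = n := by simp [cst]

theorem cst_intCast (n : ℤ) : cst n = n := by simp [cst]

theorem cst_inv_mul_intCast {n : ℤ} (hn : n ≠ 0) : cst ((n : ℂ)⁻¹) * (n : K) = 1 := by
  rw [← cst_intCast, ← cst_mul, inv_mul_cancel₀ (by exact_mod_cast hn), cst_one]

theorem isUnit_natCast {n : ℕ} (hn : n ≠ 0) : IsUnit (n : K) :=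
  IsUnit.of_mul_eq_one_right (cst ((n : ℂ)⁻¹))
    (by simpa using cst_inv_mul_intCast (n := n) (by exact_mod_cast hn))

theorem isAddTorsionFree_of_module (M : Type*) [AddCommGroup M] [Module K M] :
    IsAddTorsionFree M where
  nsmul_right_injective n hn u v huv := by
    simp only [← Nat.cast_smul_eq_nsmul K] at huv
    exact (isUnit_natCast hn).smul_left_cancel.1 huv

instance : IsAddTorsionFree K' := isAddTorsionFree_of_module K'

instance : IsAddTorsionFree (Op ℓ) := isAddTorsionFree_of_module (Op ℓ)

theorem qpow_zero : qpow 0 = 1 := by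
  ext j k
  rcases k with _ | k <;> rcases j with _ | j <;>
    simp [qpow, PowerSeries.coeff_one, Polynomial.coeff_one]

theorem qpow_add (γ δ : ℂ[X]) : qpow (γ + δ) = qpow γ * qpow δ := by
  ext j k
  have e : ∀ x ∈ Finset.HasAntidiagonal.antidiagonal k, (k.choose x.1 •
      (γ ^ x.1 * δ ^ x.2)).coeff j /
      (k.factorial : ℂ) = ∑ y ∈ Finset.HasAntidiagonal.antidiagonal j,
        ((γ ^ x.1).coeff y.1 / (x.1.factorial : ℂ)) *
          ((δ ^ x.2).coeff y.2 / (x.2.factorial : ℂ)) := by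
    rintro ⟨m, n⟩ hx
    have hx := Finset.HasAntidiagonal.mem_antidiagonal.1 hx
    simp only at hx ⊢
    subst hx
    rw [Polynomial.coeff_smul, Polynomial.coeff_mul, Finset.smul_sum, Finset.sum_div]
    refine Finset.sum_congr rfl fun y _ => ?_
    have h0 := Nat.choose_symm_add (a := m) (b := n)
    have h1 := Nat.add_choose_mul_factorial_mul_factorial m n
    have h2 : ((m + n).factorial : ℂ) ≠ 0 := by exact_mod_cast Nat.factorial_ne_zero _
    have h3 : (m.factorial : ℂ) ≠ 0 := by exact_mod_cast Nat.factorial_ne_zero _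
    have h4 : (n.factorial : ℂ) ≠ 0 := by exact_mod_cast Nat.factorial_ne_zero _
    rw [nsmul_eq_mul]
    field_simp
    rw [← h1, h0]
    push_cast
    ring
  rw [qpow, qpow, qpow, PowerSeries.coeff_mul, map_sum]
  simp only [PowerSeries.coeff_mk, PowerSeries.coeff_mul]
  rw [Finset.sum_comm, (Commute.all γ δ).add_pow', Polynomial.finsetSum_coeff, Finset.sum_div,
    Finset.sum_congr rfl e]

/-- The unit `q ^ γ` of `K'`. -/
def qUnit (γ : ℂ[X]) : K'ˣ :=
  Units.map (algebraMap K K' : K →* K')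
    ⟨qpow γ, qpow (-γ), by rw [← qpow_add, add_neg_cancel, qpow_zero],
      by rw [← qpow_add, neg_add_cancel, qpow_zero]⟩

theorem val_qUnit (γ : ℂ[X]) : (qUnit γ : K') = algebraMap K K' (qpow γ) := rfl

theorem qUnit_add (γ δ : ℂ[X]) : qUnit (γ + δ) = qUnit γ * qUnit δ := by
  ext
  rw [Units.val_mul, val_qUnit, val_qUnit, val_qUnit, qpow_add, map_mul]


theorem qUnit_zero : qUnit 0 = 1 := by
  ext
  rw [val_qUnit, qpow_zero, map_one, Units.val_one]

theorem qUnit_neg (γ : ℂ[X]) : qUnit (-γ) = (qUnit γ)⁻¹ := by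
  rw [eq_inv_iff_mul_eq_one, ← qUnit_add, neg_add_cancel, qUnit_zero]

theorem qUnit_zsmul (n : ℤ) (γ : ℂ[X]) : qUnit (n • γ) = qUnit γ ^ n :=
  map_zpow (MonoidHom.mk' (M := Multiplicative ℂ[X]) (fun γ => qUnit γ.toAdd) fun _ _ =>
    qUnit_add _ _) (Multiplicative.ofAdd γ) n

/-! ### Coefficients of exponentials -/

section

variable {R : Type*} [Ring R]

theorem coeff_pow_of_lt {C : PowerSeries R} (hC : PowerSeries.coeff 0 C = 0) (k : ℕ) :
    ∀ p < k, PowerSeries.coeff p (C ^ k) = 0 := by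
  induction k with
  | zero => simp
  | succ k ih =>
    intro p hp
    rw [pow_succ, PowerSeries.coeff_mul]
    refine Finset.sum_eq_zero fun ⟨m, n⟩ hx => ?_
    have hx := Finset.HasAntidiagonal.mem_antidiagonal.1 hx
    simp only at hx ⊢
    rcases Nat.eq_zero_or_pos n with rfl | hn
    · rw [hC, mul_zero]
    · rw [ih m (by omega), zero_mul]

/-- The Euler operator `w d/dw`. -/
def euler (f : PowerSeries R) : PowerSeries R := PowerSeries.mk fun p => p • PowerSeries.coeff p f

theorem euler_mul (f g : PowerSeries R) : euler (f * g) = euler f * g + f * euler g := by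
  ext p
  rw [map_add, euler, PowerSeries.coeff_mk, PowerSeries.coeff_mul, PowerSeries.coeff_mul,
    PowerSeries.coeff_mul, Finset.smul_sum, ← Finset.sum_add_distrib]
  refine Finset.sum_congr rfl fun ⟨m, n⟩ hx => ?_
  have hx := Finset.HasAntidiagonal.mem_antidiagonal.1 hx
  simp only at hx ⊢
  rw [euler, euler, PowerSeries.coeff_mk, PowerSeries.coeff_mk, ← hx, add_smul, smul_mul_assoc,
    mul_smul_comm]

theorem commute_powerSeries {f g : PowerSeries R}
    (h : ∀ m n, Commute (PowerSeries.coeff m f) (PowerSeries.coeff n g)) : Commute f g := by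
  change f * g = g * f
  ext p
  rw [PowerSeries.coeff_mul, PowerSeries.coeff_mul, ← Finset.Nat.sum_antidiagonal_swap]
  exact Finset.sum_congr rfl fun x _ => (h _ _).eq

theorem euler_pow {C : PowerSeries R}
    (h : ∀ m n, Commute (PowerSeries.coeff m C) (PowerSeries.coeff n C)) (k : ℕ) :
    euler (C ^ (k + 1)) = (k + 1) • (euler C * C ^ k) := by
  have hc : Commute C (euler C) := commute_powerSeries fun m n => by
    rw [euler, PowerSeries.coeff_mk]
    exact (h m n).smul_right n
  induction k with
  | zero => simp
  | succ k ih =>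
    rw [pow_succ', euler_mul, ih, mul_smul_comm, ← mul_assoc, hc.eq, mul_assoc, ← pow_succ']
    module

theorem isExp_powerSeries [IsAddTorsionFree R] [Module K R] [IsScalarTower K R R]
    [SMulCommClass K R R] {c : ℕ → R} (h : ∀ m n, Commute (c m) (c n)) :
    IsExp c (fun z => if 0 ≤ z then ∑ k ∈ Finset.range (z.toNat + 1), cst ((k.factorial : ℂ)⁻¹) •
      PowerSeries.coeff z.toNat ((PowerSeries.mk fun m => if m =
          0 then 0 else c m) ^ k) else 0) where
  neg z hz := if_neg (by omega)
  zero := by simp [cst_one]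
  step r N hN := by
    obtain ⟨C, hC⟩ : ∃ C : PowerSeries R, C = PowerSeries.mk fun m => if m = 0 then 0 else c m :=
      ⟨_, rfl⟩
    have hC0 : PowerSeries.coeff 0 C = 0 := by simp [hC]
    have hcomm : ∀ m n, Commute (PowerSeries.coeff m C) (PowerSeries.coeff n C) := by
      intro m n
      simp only [hC, PowerSeries.coeff_mk]
      split_ifs <;> simp [h]
    obtain ⟨E, hEdef⟩ : ∃ E : ℕ → R, ∀ p, E p = ∑ k ∈ Finset.range (p + 1),
        cst ((k.factorial : ℂ)⁻¹) • PowerSeries.coeff p (C ^ k) := ⟨_, fun _ => rfl⟩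
    simp only [← hC, ← hEdef]
    have hE : ∀ p N : ℕ, p < N → E p = ∑ k ∈ Finset.range N,
        cst ((k.factorial : ℂ)⁻¹) • PowerSeries.coeff p (C ^ k) := by
      intro p N hp
      rw [hEdef]
      refine Finset.sum_subset (by simpa using hp) fun k _ hk => ?_
      rw [coeff_pow_of_lt hC0 k p (by simpa using hk), smul_zero]
    rcases lt_or_ge r 0 with hr | hr
    · rw [if_neg (by omega), smul_zero, Finset.sum_eq_zero]
      intro m _
      rw [if_neg (by omega), mul_zero, smul_zero]
    lift r to ℕ using hr
    have hlast : PowerSeries.coeff r (euler C * C ^ r) = 0 := by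
      have := congrArg (PowerSeries.coeff r) (euler_pow hcomm r)
      rw [euler, PowerSeries.coeff_mk, coeff_pow_of_lt hC0 _ _ (by omega), smul_zero,
          map_nsmul] at this
      exact (smul_eq_zero_iff_right (by omega : r + 1 ≠ 0)).1 this.symm
    have rhs : ∑ m ∈ Finset.range N, (m : ℤ) • (c m * if 0 ≤ (r - m : ℤ) then E
        (r - m : ℤ).toNat else 0) =
        ∑ k ∈ Finset.range (r + 1), cst ((k.factorial : ℂ)⁻¹) •
          PowerSeries.coeff r (euler C * C ^ k) := by
      have e : ∀ m ∈ Finset.range (r + 1), (m : ℤ) • (c m * if 0 ≤ (r - m : ℤ) then E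
          (r - m : ℤ).toNat else 0) =
          ∑ k ∈ Finset.range (r + 1), cst ((k.factorial : ℂ)⁻¹) •
            (PowerSeries.coeff m (euler C) * PowerSeries.coeff (r - m) (C ^ k)) := by
        intro m hm
        have hm := Finset.mem_range.1 hm
        rw [if_pos (by omega), hE _ (r + 1) (by omega), show ((r : ℤ) - m).toNat = r - m by omega,
          Finset.mul_sum, Finset.smul_sum]
        refine Finset.sum_congr rfl fun k _ => ?_
        rw [euler, PowerSeries.coeff_mk, hC, PowerSeries.coeff_mk, mul_smul_comm, natCast_zsmul,
          smul_comm, smul_mul_assoc]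
        split_ifs with h0
        · simp [h0]
        · rfl
      rw [← Finset.sum_subset (Finset.range_subset_range.2 (by omega : r + 1 ≤ N)) fun m _ hm => ?_,
        Finset.sum_congr rfl e, Finset.sum_comm]
      · refine Finset.sum_congr rfl fun k _ => ?_
        rw [PowerSeries.coeff_mul, Finset.Nat.sum_antidiagonal_eq_sum_range_succ_mk,
            Finset.smul_sum]
      · rw [if_neg (by simp at hm; omega), mul_zero, smul_zero]
    have hfac : ∀ k : ℕ, (k + 1) • cst (((k + 1).factorial : ℂ)⁻¹) = cst ((k.factorial : ℂ)⁻¹) := by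
      intro k
      rw [nsmul_eq_mul, ← cst_natCast, ← cst_mul, Nat.factorial_succ]
      congr 1
      have h3 : (k.factorial : ℂ) ≠ 0 := by exact_mod_cast Nat.factorial_ne_zero _
      have h4 : ((k + 1 : ℕ) : ℂ) ≠ 0 := by exact_mod_cast Nat.succ_ne_zero k
      push_cast at h4 ⊢
      field_simp
    rw [rhs, Finset.sum_range_succ, hlast, smul_zero, add_zero, if_pos (by omega),
      Int.toNat_natCast, hE r (r + 1) (by omega), natCast_zsmul, Finset.sum_range_succ', smul_add,
      Finset.smul_sum]
    have hz : r • cst (((0 : ℕ).factorial : ℂ)⁻¹) • PowerSeries.coeff r (C ^ 0) = 0 := by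
      rw [pow_zero, PowerSeries.coeff_one]
      split_ifs with h0
      · simp [h0]
      · simp
    rw [hz, add_zero]
    refine Finset.sum_congr rfl fun k _ => ?_
    have := congrArg (PowerSeries.coeff r) (euler_pow hcomm k)
    rw [euler, PowerSeries.coeff_mk, map_nsmul] at this
    rw [smul_comm, this, ← hfac k, smul_comm, smul_assoc]

end

/-- The coefficients of `exp (∑ m > 0, c m w ^ m)`, extended by zero to negative indices. -/
def expSeq (c : ℕ → Op ℓ) (z : ℤ) : Op ℓ := if 0 ≤ z then expCoeff c z.toNat else 0

theorem isExp_expSeq {c : ℕ → Op ℓ} (h : ∀ m n, Commute (c m) (c n)) : IsExp c (expSeq c) :=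
  isExp_powerSeries h

theorem lowDeg_mono {N N' : ℕ} (h : N ≤ N') : lowDeg ℓ N ≤ lowDeg ℓ N' :=
  fun _ hv μ d hd => (hv μ d hd).trans_le h

theorem lowers_expSeq {c : ℕ → Op ℓ} (hc : ∀ m, 0 < m → Lowers m (c m)) (z : ℤ) :
    Lowers z.toNat (expSeq c z) := by
  rw [expSeq]
  split_ifs
  · exact lowers_expCoeff hc _
  · exact lowers_zero

theorem normExp_apply_of_mem {c : ℤ → Op ℓ} (hc : ∀ m : ℕ, 0 < m → Lowers m (c m)) (n : ℤ)
    {v : FockSum ℓ} {N : ℕ} (hv : v ∈ lowDeg ℓ N) :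
    normExp c n v = ∑ r ∈ Finset.range N,
      expSeq (fun m => c (-m)) (n + r) (expSeq (fun m => c m) r v) := by
  rw [normExp_apply hc, finsum_eq_sum_of_support_subset _ (s := Finset.range N)]
  · refine Finset.sum_congr rfl fun r _ => ?_
    rw [expSeq, expSeq, if_pos (Int.natCast_nonneg r), Int.toNat_natCast]
    split_ifs <;> rfl
  · intro r hr
    by_contra h1
    have := lowers_expCoeff hc r N v hv
    rw [Nat.sub_eq_zero_of_le (by simpa using h1)] at this
    apply hr
    simp only
    rw [lowDeg_zero _ this, map_zero, ite_self]

theorem commute_normExp {c : ℤ → Op ℓ} (hc : ∀ m : ℕ, 0 < m → Lowers m (c m))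
    (h1 : ∀ m n : ℕ, Commute (c m) (c n)) (h2 : ∀ m n : ℕ, Commute (c (-m)) (c (-n)))
    {Z : Op ℓ} (hZ : ∀ m, Commute Z (c m)) (n : ℤ) : Commute Z (normExp c n) := by
  change Z * normExp c n = normExp c n * Z
  refine LinearMap.ext fun v => ?_
  obtain ⟨N, hN⟩ := exists_lowDeg v
  obtain ⟨N', hN'⟩ := exists_lowDeg (Z v)
  rw [Module.End.mul_apply, Module.End.mul_apply,
    normExp_apply_of_mem hc n (lowDeg_mono (le_max_left N N') hN),
    normExp_apply_of_mem hc n (lowDeg_mono (le_max_right N N') hN'), map_sum]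
  refine Finset.sum_congr rfl fun r _ => ?_
  rw [← Module.End.mul_apply, ((isExp_expSeq h2).commute (fun m => hZ (-m)) _).eq,
    Module.End.mul_apply, ← Module.End.mul_apply Z,
    ((isExp_expSeq h1).commute (fun m => hZ m) _).eq]
  rfl

/-! ### The Heisenberg relations -/

/-- The extension of an operator on the Fock modules to their direct sum. -/
def fockMap (ℓ : ℕ) : Module.End K' (Fock ℓ) →+* Op ℓ where
  toFun T := Finsupp.mapRange.linearMap T
  map_one' := Finsupp.mapRange.linearMap_id
  map_mul' S T := Finsupp.mapRange.linearMap_comp S T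
  map_zero' := by ext; simp
  map_add' S T := by ext; simp

theorem fockMap_smul (c : K) (T : Module.End K' (Fock ℓ)) : fockMap ℓ (c • T) = c •
    fockMap ℓ T := by
  ext; simp [fockMap]

theorem x_eq_fockMap (C : Matrix (Fin ℓ) (Fin ℓ) ℤ) (i : Fin ℓ) (n : ℤ) :
    x C i n = fockMap ℓ (xFock C i n) := rfl

theorem xFock_zero (C : Matrix (Fin ℓ) (Fin ℓ) ℤ) (i : Fin ℓ) : xFock C i 0 = 0 := by simp [xFock]

theorem x_zero (C : Matrix (Fin ℓ) (Fin ℓ) ℤ) (i : Fin ℓ) : x C i 0 = 0 := by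
  rw [x_eq_fockMap, xFock_zero, map_zero]

theorem xFock_neg (C : Matrix (Fin ℓ) (Fin ℓ) ℤ) (i : Fin ℓ) {n : ℕ} (hn : 0 < n) :
    xFock C i (-n) = LinearMap.mulLeft K' (MvPolynomial.X (i, n.toPNat')) := by
  rw [xFock, if_pos (by omega)]
  simp

theorem xFock_pos (C : Matrix (Fin ℓ) (Fin ℓ) ℤ) (i : Fin ℓ) {n : ℕ} (hn : 0 < n) :
    xFock C i n = ∑ j, (((n : ℤ) : K) * tqRatio n * cartanQT C n i j) •
      (MvPolynomial.pderiv (j, n.toPNat')).toLinearMap := by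
  rw [xFock, if_neg (by omega), if_pos (by omega)]
  simp

theorem commute_pderiv {σ R : Type*} [CommRing R] (s t : σ) :
    Commute ((MvPolynomial.pderiv s : Derivation R (MvPolynomial σ R) _).toLinearMap :
      Module.End R (MvPolynomial σ R)) (MvPolynomial.pderiv t).toLinearMap := by
  classical
  have : ⁅(MvPolynomial.pderiv s : Derivation R (MvPolynomial σ R) (MvPolynomial σ R)),
      (MvPolynomial.pderiv t : Derivation R (MvPolynomial σ R) (MvPolynomial σ R))⁆ = 0 := by
    apply MvPolynomial.derivation_ext
    intro u
    simp [Derivation.commutator_apply, MvPolynomial.pderiv_X, Pi.single_apply, apply_ite]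
  refine LinearMap.ext fun f => ?_
  have := congrArg (fun D => D f) this
  simpa [Derivation.commutator_apply, sub_eq_zero] using this

theorem pderiv_mul_mulLeft {σ R : Type*} [CommRing R] [DecidableEq σ] (s t : σ) :
    ((MvPolynomial.pderiv s : Derivation R (MvPolynomial σ R) _).toLinearMap :
      Module.End R (MvPolynomial σ R)) * LinearMap.mulLeft R (MvPolynomial.X t) =
    LinearMap.mulLeft R (MvPolynomial.X t) * (MvPolynomial.pderiv s).toLinearMap +
      if t = s then 1 else 0 := by
  refine LinearMap.ext fun f => ?_
  simp only [Module.End.mul_apply, LinearMap.mulLeft_apply, Derivation.coeFn_coe,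
      MvPolynomial.pderiv_mul, MvPolynomial.pderiv_X, LinearMap.add_apply,
    Pi.single_apply]
  split_ifs <;> simp_all [add_comm]

theorem commute_x_neg (C : Matrix (Fin ℓ) (Fin ℓ) ℤ) (i j : Fin ℓ) (m n : ℕ) :
    Commute (x C i (-m)) (x C j (-n)) := by
  rcases Nat.eq_zero_or_pos m with rfl | hm
  · simp [x_zero]
  rcases Nat.eq_zero_or_pos n with rfl | hn
  · simp [x_zero]
  rw [x_eq_fockMap, x_eq_fockMap, xFock_neg C i hm, xFock_neg C j hn]
  refine Commute.map ?_ _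
  refine LinearMap.ext fun f => ?_
  simp only [Module.End.mul_apply, LinearMap.mulLeft_apply]
  ring

theorem commute_x_pos (C : Matrix (Fin ℓ) (Fin ℓ) ℤ) (i j : Fin ℓ) (m n : ℕ) :
    Commute (x C i m) (x C j n) := by
  rcases Nat.eq_zero_or_pos m with rfl | hm
  · simp [x_zero]
  rcases Nat.eq_zero_or_pos n with rfl | hn
  · simp [x_zero]
  rw [x_eq_fockMap, x_eq_fockMap, xFock_pos C i hm, xFock_pos C j hn]
  refine Commute.map (Commute.sum_left _ _ _ fun k _ => Commute.sum_right _ _ _ fun k' _ => ?_) _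
  exact ((commute_pderiv _ _).smul_left _).smul_right _

theorem x_mul_x_neg (C : Matrix (Fin ℓ) (Fin ℓ) ℤ) (i j : Fin ℓ) (m n : ℕ) :
    x C i m * x C j (-n) = x C j (-n) * x C i m +
      if n = m then (((m : ℤ) : K) * tqRatio m * cartanQT C m i j) • 1 else 0 := by
  rcases Nat.eq_zero_or_pos m with rfl | hm
  · simp [x_zero]
  rcases Nat.eq_zero_or_pos n with rfl | hn
  · simp [x_zero, hm.ne]
  have e : ∀ k : Fin ℓ, (j, n.toPNat') = (k, m.toPNat') ↔ k = j ∧ n = m := by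
    intro k
    rw [Prod.mk.injEq, ← PNat.coe_inj, Nat.toPNat'_coe, Nat.toPNat'_coe, if_pos hm, if_pos hn]
    exact and_congr_left' eq_comm
  rw [x_eq_fockMap, x_eq_fockMap, xFock_pos C i hm, xFock_neg C j hn, ← map_mul, ← map_mul,
    Finset.sum_mul, Finset.mul_sum]
  simp only [smul_mul_assoc, mul_smul_comm, pderiv_mul_mulLeft, smul_add, Finset.sum_add_distrib,
    map_add, e]
  congr 1
  split_ifs with h
  · simp [h, fockMap_smul]
  · simp [h]

/-- The element `t ^ m - t ^ (-m)` of `K`. -/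
def tdiff (m : ℤ) : K := qpow (expo 0 m) - qpow (-expo 0 m)

theorem expo_neg (m n : ℤ) : expo (-m) (-n) = -expo m n := by simp [expo]; ring

theorem cartanQT_neg (C : Matrix (Fin ℓ) (Fin ℓ) ℤ) (m : ℤ) : cartanQT C (-m) = cartanQT C m := by
  ext1 i j
  simp only [cartanQT, Matrix.of_apply, neg_neg, add_comm]

theorem cartanQT_symm {C : Matrix (Fin ℓ) (Fin ℓ) ℤ} (hC : C.IsSymm) (m : ℤ) (i j : Fin ℓ) :
    cartanQT C m i j = cartanQT C m j i := by
  simp only [cartanQT, Matrix.of_apply, hC.apply i j, eq_comm]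

theorem isUnit_det_cartanQT {C : Matrix (Fin ℓ) (Fin ℓ) ℤ} (hC : C.det ≠ 0) (m : ℤ) :
    IsUnit (cartanQT C m).det := by
  rw [PowerSeries.isUnit_iff_constantCoeff, PowerSeries.isUnit_iff_constantCoeff,
    isUnit_iff_ne_zero]
  have e : ((PowerSeries.constantCoeff (R := ℂ)).comp PowerSeries.constantCoeff).mapMatrix
      (cartanQT C m) = (Int.castRingHom ℂ).mapMatrix C := by
    ext i j
    have h0 : ∀ γ, PowerSeries.constantCoeff (PowerSeries.constantCoeff (qpow γ)) = 1 := by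
      intro γ
      rw [← PowerSeries.coeff_zero_eq_constantCoeff_apply,
        ← PowerSeries.coeff_zero_eq_constantCoeff_apply]
      simp [qpow]
    simp only [cartanQT, RingHom.mapMatrix_apply, Matrix.map_apply, Matrix.of_apply,
      RingHom.comp_apply, map_sub, map_intCast]
    split_ifs
    · simp [h0]; norm_num
    · simp
  have e2 := congrArg Matrix.det e
  rw [← RingHom.map_det, ← RingHom.map_det] at e2
  simp only [RingHom.comp_apply] at e2
  rw [e2]
  simpa using hC

variable {C : Matrix (Fin ℓ) (Fin ℓ) ℤ}

theorem tqRatio_scalar {m : ℕ} (hm : 0 < m) :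
    (cst (((m : ℤ) : ℂ)⁻¹) * (qpow (expo m 0) - qpow (-expo m 0))) *
      (((m : ℤ) : K) * tqRatio m) = tdiff m := by
  have h1 := cst_inv_mul_intCast (n := m) (by omega)
  have h2 := tqRatio_mul (n := m) (by omega)
  rw [tdiff, ← h2]
  linear_combination (tqRatio m * (qpow (expo m 0) - qpow (-expo m 0))) * h1

theorem sum_scalar (hC : C.det ≠ 0) (i j : Fin ℓ) {m : ℕ} (hm : 0 < m) :
    ∑ k, (cartanQT C m)⁻¹ k j * ((cst (((m : ℤ) : ℂ)⁻¹) * (qpow (expo m 0) - qpow (-expo m 0))) *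
      (((m : ℤ) : K) * tqRatio m * cartanQT C m i k)) = if j = i then tdiff m else 0 := by
  have h1 := congrFun (congrFun (Matrix.mul_nonsing_inv _ (isUnit_det_cartanQT hC m)) i) j
  rw [Matrix.mul_apply, Matrix.one_apply] at h1
  have h2 : (if j = i then tdiff m else 0) = tdiff m * if i = j then 1 else 0 := by
    simp [eq_comm]
  rw [h2, ← h1, Finset.mul_sum]
  refine Finset.sum_congr rfl fun k _ => ?_
  rw [← tqRatio_scalar hm]
  ring

theorem y_zero (j : Fin ℓ) : y C j 0 = 0 := by simp [y, a, x_zero]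

theorem tdiff_zero : tdiff 0 = 0 := by simp [tdiff, expo]

theorem x_mul_y_neg (hC : C.det ≠ 0) (i j : Fin ℓ) (m n : ℕ) :
    x C i m * y C j (-n) = y C j (-n) * x C i m +
      if n = m then (if j = i then tdiff m else 0) • 1 else 0 := by
  rcases Nat.eq_zero_or_pos m with rfl | hm
  · simp [x_zero, tdiff_zero]
  have e : cst (((-m : ℤ) : ℂ)⁻¹) * (qpow (expo (-m) 0) - qpow (-expo (-m) 0)) =
      cst (((m : ℤ) : ℂ)⁻¹) * (qpow (expo m 0) - qpow (-expo m 0)) := by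
    rw [show expo (-m) 0 = -expo m 0 by rw [← expo_neg, neg_zero], neg_neg, Int.cast_neg, inv_neg,
      cst_neg]
    ring
  simp only [y, a, Finset.mul_sum, Finset.sum_mul, mul_smul_comm, smul_mul_assoc, x_mul_x_neg,
    smul_add, Finset.sum_add_distrib]
  congr 1
  by_cases h : n = m
  · subst h
    simp only [if_pos, smul_smul, ← Finset.sum_smul]
    rw [← sum_scalar hC i j hm, cartanQT_neg, e]
  · simp [h]

theorem y_mul_x_neg (hS : C.IsSymm) (hC : C.det ≠ 0) (i j : Fin ℓ) (m n : ℕ) :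
    y C j m * x C i (-n) = x C i (-n) * y C j m +
      if n = m then (if j = i then tdiff m else 0) • 1 else 0 := by
  rcases Nat.eq_zero_or_pos m with rfl | hm
  · simp [y_zero, tdiff_zero]
  simp only [y, a, Finset.mul_sum, Finset.sum_mul, mul_smul_comm, smul_mul_assoc, x_mul_x_neg,
    smul_add, Finset.sum_add_distrib]
  congr 1
  by_cases h : n = m
  · subst h
    simp only [if_pos, smul_smul, ← Finset.sum_smul]
    rw [← sum_scalar hC i j hm]
    simp only [cartanQT_symm hS n _ i, mul_assoc]
  · simp [h]

/-! ### The modes of monomials -/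

/-- The exponents of the `Y_i(z a)` in a monomial, for a fixed node `i`. -/
def atNode (i : Fin ℓ) : Mono ℓ →+ (Spec →₀ ℤ) :=
  Finsupp.liftAddHom fun p => if p.1 = i then Finsupp.singleAddHom p.2 else 0

theorem atNode_single (i : Fin ℓ) (p : Fin ℓ × Spec) (e : ℤ) :
    atNode i (Finsupp.single p e) = if p.1 = i then Finsupp.single p.2 e else 0 := by
  rw [atNode, Finsupp.liftAddHom_apply_single]
  split_ifs <;> simp

/-- The modes of the exponent of a monomial. -/
def modes (C : Matrix (Fin ℓ) (Fin ℓ) ℤ) (d : Mono ℓ) (m : ℤ) : Op ℓ :=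
  d.sum fun p e => ((e : K) * p.2.zpow (-m)) • y C p.1 m

theorem modes_zero (m : ℤ) : modes C 0 m = 0 := rfl

theorem modes_add (d d' : Mono ℓ) (m : ℤ) : modes C (d + d') m = modes C d m + modes C d' m :=
  Finsupp.sum_add_index' (by simp) (by intros; rw [Int.cast_add, add_mul, add_smul])

theorem modes_single (p : Fin ℓ × Spec) (e m : ℤ) :
    modes C (Finsupp.single p e) m = ((e : K) * p.2.zpow (-m)) • y C p.1 m :=
  Finsupp.sum_single_index (by simp)

/-- The power sum `∑ e * s ^ m` of a divisor of spectral parameters. -/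
def powerSum (m : ℤ) : (Spec →₀ ℤ) →+ K :=
  Finsupp.liftAddHom fun s => (AddMonoidHom.mulRight (s.zpow m)).comp (Int.castAddHom K)

theorem powerSum_single (m : ℤ) (s : Spec) (e : ℤ) :
    powerSum m (Finsupp.single s e) = e * s.zpow m := by
  simp [powerSum]

theorem x_mul_modes_neg (hC : C.det ≠ 0) (i : Fin ℓ) (d : Mono ℓ) (m n : ℕ) :
    x C i m * modes C d (-n) = modes C d (-n) * x C i m +
      if n = m then (powerSum m (atNode i d) * tdiff m) • 1 else 0 := by
  induction d using Finsupp.induction_linear with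
  | zero => simp [modes_zero]
  | add d d' hd hd' =>
    rw [modes_add, mul_add, hd, hd', map_add, map_add, add_mul (modes C d _)]
    split_ifs
    · rw [add_mul (powerSum _ _), add_smul]; abel
    · simp
  | single p e =>
    rw [modes_single, mul_smul_comm, x_mul_y_neg hC, atNode_single, smul_mul_assoc, smul_add]
    congr 1
    split_ifs with h h'
    · rw [powerSum_single, smul_smul, neg_neg, h]
    · simp
    · simp

theorem modes_mul_x_neg (hS : C.IsSymm) (hC : C.det ≠ 0) (i : Fin ℓ) (d : Mono ℓ) (m n : ℕ) :
    modes C d m * x C i (-n) = x C i (-n) * modes C d m +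
      if n = m then (powerSum (-m) (atNode i d) * tdiff m) • 1 else 0 := by
  induction d using Finsupp.induction_linear with
  | zero => simp [modes_zero]
  | add d d' hd hd' =>
    rw [modes_add, add_mul, hd, hd', map_add, map_add, mul_add]
    split_ifs
    · rw [add_mul (powerSum _ _), add_smul]; abel
    · simp
  | single p e =>
    rw [modes_single, smul_mul_assoc, y_mul_x_neg hS hC, atNode_single, mul_smul_comm, smul_add]
    congr 1
    split_ifs with h h'
    · rw [powerSum_single, smul_smul]
    · simp
    · simp

theorem commute_modes {Z : Op ℓ} {m : ℤ} (h : ∀ j, Commute Z (x C j m)) (d : Mono ℓ) :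
    Commute Z (modes C d m) := by
  refine Commute.sum_right _ _ _ fun p _ => (Commute.sum_right _ _ _ fun j _ => ?_).smul_right _
  exact ((h j).smul_right _).smul_right _

theorem lowers_modes (d : Mono ℓ) {m : ℕ} (hm : 0 < m) : Lowers m (modes C d m) :=
  lowers_mono C d hm

/-! ### Commutation with screening currents -/

theorem val_qUnit_zpow (γ : ℂ[X]) (m : ℤ) :
    ((qUnit γ ^ m : K'ˣ) : K') = algebraMap K K' (qpow (m • γ)) := by
  rw [← qUnit_zsmul, val_qUnit]

theorem algebraMap_zpow_spec (k m : ℤ) :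
    algebraMap K K' (Spec.zpow (1, k, -k) m) = (qUnit (expo k (-k)) ^ m : K'ˣ) := by
  rw [val_qUnit_zpow, Spec.zpow]
  congr 1
  simp only [one_zpow, Units.val_one, cst_one, one_mul]
  congr 1
  simp only [expo, zsmul_eq_mul]
  push_cast
  simp only [map_neg, map_mul]
  simp
  ring

/-- The data entering a screening current `exp (∑ m ≠ 0, c m x_i[m] w ^ (-m))`, whose contraction
with `Y_i(z)` is `(w - q ^ (-π) z) / (w - q ^ π z)`. -/
structure IsScreening (c : ℤ → K') (π π' : ℂ[X]) : Prop where
  add_eq : π + π' = Polynomial.X - 1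
  contraction : ∀ m : ℤ, m • (c m * algebraMap K K' (tdiff m)) =
    ((qUnit π ^ m : K'ˣ) : K') - (qUnit π ^ (-m) : K'ˣ)
  shift : ∀ m : ℤ, c m * (((qUnit π' ^ m : K'ˣ) : K') - (qUnit π' ^ (-m) : K'ˣ)) =
    -algebraMap K K' (cst ((m : ℂ)⁻¹) * (qpow (expo m 0) - qpow (-expo m 0)))

/-- The coefficient at `w ^ (-1)` of a screening current, with its shift operator. -/
def screen (C : Matrix (Fin ℓ) (Fin ℓ) ℤ) (i : Fin ℓ) (c : ℤ → K') (π : ℂ[X]) : Op ℓ :=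
  expQ i (-π) * normExp (fun m => c m • x C i m) (-1)

theorem isExp_of_commute {c : ℕ → K'} : ∃ G, IsExp c G :=
  ⟨_, isExp_powerSeries fun _ _ => Commute.all _ _⟩

theorem tdiff_neg (m : ℤ) : tdiff (-m) = -tdiff m := by
  rw [tdiff, tdiff, show expo 0 (-m) = -expo 0 m by rw [← expo_neg, neg_zero], neg_neg, neg_sub]

theorem contraction_single {c : ℤ → K'} {π π' : ℂ[X]} (hc : IsScreening c π π') {e : ℤ}
    (he : e = 0 ∨ e = 1 ∨ e = -1) (k m : ℤ) :
    m • (c m * algebraMap K K' (powerSum m (Finsupp.single (1, k, -k) e) * tdiff m)) =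
      ((qUnit (e • π + expo k (-k)) ^ m : K'ˣ) : K') -
        (qUnit (-(e • π) + expo k (-k)) ^ m : K'ˣ) := by
  have h := hc.contraction m
  rw [powerSum_single, map_mul, map_mul, algebraMap_zpow_spec, map_intCast, qUnit_add, qUnit_add,
    mul_zpow, mul_zpow, Units.val_mul, Units.val_mul, ← sub_mul, qUnit_neg, inv_zpow', qUnit_zsmul]
  rw [zsmul_eq_mul] at h ⊢
  rcases he with rfl | rfl | rfl
  · simp
  · rw [zpow_one, ← h]
    push_cast
    ring
  · rw [← zpow_mul, ← zpow_mul, neg_one_mul, neg_one_mul, neg_neg, ← neg_sub, ← h]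
    push_cast
    ring

section

variable {c : ℤ → K'} {π π' : ℂ[X]}

theorem normExp_commutator (hS : C.IsSymm) (hC : C.det ≠ 0) (hc : IsScreening c π π') (i : Fin ℓ)
    (d : Mono ℓ) {e k : ℤ} (he : e = 0 ∨ e = 1 ∨ e = -1)
    (hd : atNode i d = Finsupp.single (1, k, -k) e) {P Q : K'ˣ}
    (hP : P = qUnit (e • π + expo k (-k))) (hQ : Q = qUnit (-(e • π) + expo k (-k)))
    (n : ℤ) (w : FockSum ℓ) :
    normExp (fun m => c m • x C i m) (-1) (normExp (modes C d) n w) -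
      ((Q * P⁻¹ : K'ˣ) : K') •
        normExp (modes C d) n (normExp (fun m => c m • x C i m) (-1) w) =
    ((P : K') - Q) •
      normExp (fun m => modes C d m + ((P ^ (-m) : K'ˣ) : K') • c m • x C i m) (n - 1) w := by
  obtain ⟨G, hG⟩ := isExp_of_commute
    (c := fun m : ℕ => c m * algebraMap K K' (powerSum m (atNode i d) * tdiff m))
  obtain ⟨G', hG'⟩ := isExp_of_commute
    (c := fun m : ℕ => c (-m) * algebraMap K K' (powerSum (-m) (atNode i d) * tdiff m))
  have lv : ∀ m : ℕ, 0 < m → Lowers m (c m • x C i m) := fun m hm => (lowers_x C i hm).smulK' _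
  have lc : ∀ m : ℕ, 0 < m → Lowers m (modes C d m) := fun m hm => lowers_modes d hm
  have lh : ∀ m : ℕ, 0 < m → Lowers m (modes C d m + ((P ^ (-m : ℤ) : K'ˣ) : K') • c m • x C i m) :=
    fun m hm => (lc m hm).add ((lv m hm).smulK' _)
  have v1 : ∀ m n : ℕ, Commute (c (-m) • x C i (-m)) (c (-n) • x C i (-n)) :=
    fun m n => ((commute_x_neg C i i m n).smul_left _).smul_right _
  have v2 : ∀ m n : ℕ, Commute (c m • x C i m) (c n • x C i n) :=
    fun m n => ((commute_x_pos C i i m n).smul_left _).smul_right _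
  have vc1 : ∀ m n : ℕ, Commute (c (-m) • x C i (-m)) (modes C d (-n)) :=
    fun m n => (commute_modes (fun j => commute_x_neg C i j m n) d).smul_left _
  have vc2 : ∀ m n : ℕ, Commute (c m • x C i m) (modes C d n) :=
    fun m n => (commute_modes (fun j => commute_x_pos C i j m n) d).smul_left _
  have cc1 : ∀ m n : ℕ, Commute (modes C d (-m)) (modes C d (-n)) :=
    fun m n => commute_modes (fun j => (commute_modes (fun i => commute_x_neg C j i n m) d).symm) d
  have cc2 : ∀ m n : ℕ, Commute (modes C d m) (modes C d n) :=
    fun m n => commute_modes (fun j => (commute_modes (fun i => commute_x_pos C j i n m) d).symm) d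
  obtain ⟨N, hN⟩ := exists_lowDeg w
  obtain ⟨N₁, hN₁⟩ := exists_lowDeg (normExp (modes C d) n w)
  obtain ⟨N₂, hN₂⟩ := exists_lowDeg (normExp (fun m => c m • x C i m) (-1) w)
  obtain ⟨L, hL⟩ : ∃ L, L = 2 * N + n.natAbs + 2 + N₁ + N₂ := ⟨_, rfl⟩
  have hw : w ∈ lowDeg ℓ L := lowDeg_mono (by omega) hN
  have hw₁ : normExp (modes C d) n w ∈ lowDeg ℓ L := lowDeg_mono (by omega) hN₁
  have hw₂ : normExp (fun m => c m • x C i m) (-1) w ∈ lowDeg ℓ L := lowDeg_mono (by omega) hN₂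
  have key := normOrd_commutator (c := modes C d) (v := fun m => c m • x C i m) P Q
    (isExp_expSeq cc1) (isExp_expSeq cc2) (isExp_expSeq v1) (isExp_expSeq v2)
    (Hm := expSeq fun m : ℕ => modes C d (-m) + ((P ^ (m : ℤ) : K'ˣ) : K') • c (-m) • x C i (-m))
    (Hp := expSeq fun m : ℕ => modes C d m + ((P ^ (-m : ℤ) : K'ˣ) : K') • c m • x C i m)
    (isExp_expSeq fun m n => ((cc1 m n).add_left ((vc1 m n).smul_left _)).add_right
      ((((vc1 n m).symm).add_left ((v1 m n).smul_left _)).smul_right _))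
    (isExp_expSeq fun m n => ((cc2 m n).add_left ((vc2 m n).smul_left _)).add_right
      ((((vc2 n m).symm).add_left ((v2 m n).smul_left _)).smul_right _))
    hG hG' ?_ ?_ ?_ ?_ vc1 vc2 w N ?_ n L (by omega)
  · have a1 := normExp_apply_of_mem (c := fun m => c m • x C i m) lv (-1) hw₁
    have a2 := normExp_apply_of_mem lc n hw₂
    have a3 := normExp_apply_of_mem
      (c := fun m => modes C d m + ((P ^ (-m) : K'ˣ) : K') • c m • x C i m) lh (n - 1) hw
    have a4 := normExp_apply_of_mem (c := fun m => c m • x C i m) lv (-1) hw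
    have a5 := normExp_apply_of_mem lc n hw
    have e : ((P : K') - Q) = (1 - ((Q * P⁻¹ : K'ˣ) : K')) * P := by
      have := P.inv_mul
      push_cast
      linear_combination (Q : K') * this
    rw [a1, a2, a4, a5, a3, e]
    simp only [neg_neg]
    rw [← key]
    refine congrArg₂ (fun u v => u - ((Q * P⁻¹ : K'ˣ) : K') • v) ?_ ?_
    · refine Finset.sum_congr rfl fun r _ => ?_
      rw [map_sum, map_sum, show (-1 + r : ℤ) = r - 1 by ring]
    · rw [Finset.sum_comm]
      refine Finset.sum_congr rfl fun r _ => ?_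
      rw [map_sum, map_sum]
      refine Finset.sum_congr rfl fun r' _ => ?_
      rw [show (-1 + r' : ℤ) = r' - 1 by ring]
  · intro m
    have := contraction_single hc he k m
    rw [hd, hP, hQ, ← natCast_zsmul, this]
    simp
  · intro m
    have := contraction_single hc he k (-m)
    rw [tdiff_neg, mul_neg, map_neg, mul_neg, neg_smul, smul_neg, neg_neg] at this
    rw [hd, hP, hQ, ← natCast_zsmul, this]
    simp
  · intro m n
    rw [smul_mul_assoc, x_mul_modes_neg hC, smul_add, mul_smul_comm]
    congr 1
    split_ifs
    · rw [mul_smul (c m), algebraMap_smul]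
    · simp
  · intro m n
    rw [mul_smul_comm, modes_mul_x_neg hS hC, smul_add, smul_mul_assoc]
    congr 1
    split_ifs with h
    · rw [mul_smul (c (-m)), algebraMap_smul, h]
    · simp
  · intro r r' hr
    have h1 := lowers_expSeq (c := fun m : ℕ => c m • x C i m) lv r N w hN
    have h2 := lowers_expSeq (c := fun m : ℕ => modes C d m) lc r' _ _ h1
    rw [show N - r.toNat - r'.toNat = 0 by omega] at h2
    exact lowDeg_zero _ h2

end

section

variable {C : Matrix (Fin ℓ) (Fin ℓ) ℤ}

/-! ### Zero modes -/

theorem qy0_single (ξ : Fin ℓ → ℂ[X]) (μ : Wt ℓ) (f : Fock ℓ) :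
    qy0 ξ (Finsupp.single μ f) = qpow (∑ i, ξ i * μ i) • Finsupp.single μ f := by
  simp [qy0, Finsupp.lsum_single]

theorem qy0_vacuum (ξ : Fin ℓ → ℂ[X]) (f : Fock ℓ) :
    qy0 ξ (Finsupp.single 0 f) = Finsupp.single 0 f := by
  simp [qy0_single, qpow_zero]

theorem expQ_single (i : Fin ℓ) (δ : ℂ[X]) (μ : Wt ℓ) (f : Fock ℓ) :
    expQ i δ (Finsupp.single μ f) = Finsupp.single (μ + Pi.single i δ) f := by
  simp [expQ]

theorem x_single (i : Fin ℓ) (m : ℤ) (μ : Wt ℓ) (f : Fock ℓ) :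
    x C i m (Finsupp.single μ f) = Finsupp.single μ (xFock C i m f) := by
  simp [x]

theorem commute_qy0_x (ξ : Fin ℓ → ℂ[X]) (i : Fin ℓ) (m : ℤ) : Commute (qy0 ξ) (x C i m) := by
  refine Finsupp.lhom_ext fun μ f => ?_
  rw [Module.End.mul_apply, Module.End.mul_apply, x_single, qy0_single, qy0_single,
    LinearMap.map_smul_of_tower, x_single]

theorem commute_expQ_x (i : Fin ℓ) (δ : ℂ[X]) (j : Fin ℓ) (m : ℤ) :
    Commute (expQ i δ) (x C j m) := by
  refine Finsupp.lhom_ext fun μ f => ?_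
  rw [Module.End.mul_apply, Module.End.mul_apply, x_single, expQ_single, expQ_single, x_single]

theorem commute_apply {S T : Op ℓ} (h : Commute S T) (v : FockSum ℓ) : S (T v) = T (S v) := by
  rw [← Module.End.mul_apply, h.eq, Module.End.mul_apply]

theorem qy0_mul_expQ (ξ : Fin ℓ → ℂ[X]) (i : Fin ℓ) (δ : ℂ[X]) :
    qy0 ξ * expQ i δ = qpow (ξ i * δ) • (expQ i δ * qy0 ξ) := by
  refine Finsupp.lhom_ext fun μ f => ?_
  have e : ∑ j, ξ j * (μ + Pi.single i δ : Wt ℓ) j = ξ i * δ + ∑ j, ξ j * μ j := by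
    simp only [Pi.add_apply, mul_add, Finset.sum_add_distrib]
    rw [add_comm, Finset.sum_eq_single i]
    · simp
    · intro j _ hj
      simp [hj]
    · simp
  rw [LinearMap.smul_apply, Module.End.mul_apply, Module.End.mul_apply, expQ_single, qy0_single,
    qy0_single, e, qpow_add, LinearMap.map_smul_of_tower, expQ_single, mul_smul]

/-- The exponent of the scalar prefactor of a monomial. -/
def prefactor (C : Matrix (Fin ℓ) (Fin ℓ) ℤ) (d : Mono ℓ) : ℂ[X] :=
  d.sum fun p e => Polynomial.C (e * (2 * rhoOmega C p.1)) * (Polynomial.X - 1)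

/-- The exponents of the zero modes of a monomial. -/
def zeroModes (d : Mono ℓ) (i : Fin ℓ) : ℂ[X] :=
  d.sum fun p e => if p.1 = i then Polynomial.C (2 * (e : ℂ)) else 0

theorem monoField_eq (d : Mono ℓ) (n : ℤ) : monoField C d n =
    qpow (prefactor C d) • (qy0 (zeroModes d) * normExp (modes C d) n) := rfl

theorem zeroModes_eq (d : Mono ℓ) (i : Fin ℓ) :
    zeroModes d i = (atNode i d).sum fun _ e => Polynomial.C (2 * (e : ℂ)) := by
  induction d using Finsupp.induction_linear with
  | zero => simp [zeroModes]
  | add d d' hd hd' =>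
    rw [map_add, Finsupp.sum_add_index' (by simp) (by intros; simp [mul_add]), ← hd, ← hd',
      zeroModes, Finsupp.sum_add_index' (by simp)]
    · rfl
    · intro p e e'
      split_ifs <;> simp [mul_add]
  | single p e =>
    rw [zeroModes, Finsupp.sum_single_index (by simp), atNode_single]
    split_ifs <;> simp

variable {c : ℤ → K'} {π π' : ℂ[X]}

theorem commute_normExp_modes {Z : Op ℓ} (hZ : ∀ j m, Commute Z (x C j m)) (d : Mono ℓ) (n : ℤ) :
    Commute Z (normExp (modes C d) n) :=
  commute_normExp (fun _ hm => lowers_modes d hm)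
    (fun m n => commute_modes (fun j => (commute_modes
        (fun i => commute_x_pos C j i n m) d).symm) d)
    (fun m n => commute_modes (fun j => (commute_modes
        (fun i => commute_x_neg C j i n m) d).symm) d)
    (fun m => commute_modes (fun j => hZ j m) d) n

theorem commute_normExp_current {Z : Op ℓ} (hZ : ∀ j m, Commute Z (x C j m)) (i : Fin ℓ) (n : ℤ) :
    Commute Z (normExp (fun m => c m • x C i m) n) :=
  commute_normExp (fun _ hm => (lowers_x C i hm).smulK' _)
    (fun m n => ((commute_x_pos C i i m n).smul_left _).smul_right _)
    (fun m n => ((commute_x_neg C i i m n).smul_left _).smul_right _)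
    (fun m => (hZ i m).smul_right _) n

theorem screen_monoField (hS : C.IsSymm) (hC : C.det ≠ 0) (hc : IsScreening c π π') (i : Fin ℓ)
    (d : Mono ℓ) {e k : ℤ} (he : e = 0 ∨ e = 1 ∨ e = -1)
    (hd : atNode i d = Finsupp.single (1, k, -k) e) {P Q : K'ˣ}
    (hP : P = qUnit (e • π + expo k (-k))) (hQ : Q = qUnit (-(e • π) + expo k (-k)))
    (n : ℤ) (f : Fock ℓ) :
    screen C i c π (monoField C d n (Finsupp.single 0 f)) -
      monoField C d n (screen C i c π (Finsupp.single 0 f)) =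
    ((qUnit (prefactor C d) : K') * (P - Q)) • expQ i (-π)
      (normExp (fun m => modes C d m + ((P ^ (-m) : K'ˣ) : K') • c m • x C i m) (n - 1)
        (Finsupp.single 0 f)) := by
  have hφ : algebraMap K K' (qpow (zeroModes d i * -π)) = ((Q * P⁻¹ : K'ˣ) : K') := by
    rw [hP, hQ, ← qUnit_neg, ← qUnit_add, val_qUnit, zeroModes_eq, hd,
      Finsupp.sum_single_index (by simp)]
    congr 2
    simp only [zsmul_eq_mul, map_mul, map_ofNat, map_intCast]
    ring
  have q1 := commute_apply (commute_normExp_modes (C := C) (commute_qy0_x (zeroModes d)) d n)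
  have q2 := commute_apply
    (commute_normExp_current (C := C) (c := c) (commute_qy0_x (zeroModes d)) i (-1))
  have q3 := commute_apply (commute_normExp_modes (C := C) (commute_expQ_x i (-π)) d n).symm
  have q4 : ∀ v, qy0 (zeroModes d) (expQ i (-π) v) =
      ((Q * P⁻¹ : K'ˣ) : K') • expQ i (-π) (qy0 (zeroModes d) v) := by
    intro v
    have := congrArg (fun T : Op ℓ => T v) (qy0_mul_expQ (zeroModes d) i (-π))
    simp only [Module.End.mul_apply, LinearMap.smul_apply] at this
    rw [this, ← hφ, algebraMap_smul]
  have key := normExp_commutator hS hC hc i d he hd hP hQ n (Finsupp.single 0 f)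
  have hpre : ∀ v : FockSum ℓ, qpow (prefactor C d) • v = (qUnit (prefactor C d) : K') • v :=
    fun v => by rw [val_qUnit, algebraMap_smul]
  rw [mul_smul, ← map_smul (expQ i (-π)), ← key, monoField_eq, screen]
  simp only [LinearMap.smul_apply, Module.End.mul_apply, hpre]
  rw [q1, qy0_vacuum, q3, q4, q1, q2, qy0_vacuum]
  simp only [map_smul, map_sub, smul_sub]

/-! ### Cancellation of poles -/

/-- The monomial `Y_i(z q ^ k t ^ (-k))`. -/
def nodeY (i : Fin ℓ) (k : ℤ) : Mono ℓ := Finsupp.single (i, (1, k, -k)) 1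

/-- The monomial `A_i(z q ^ k t ^ (-k))`. -/
def rootMono (C : Matrix (Fin ℓ) (Fin ℓ) ℤ) (i : Fin ℓ) (k : ℤ) : Mono ℓ :=
  nodeY i (k + 1) + nodeY i (k - 1) + ∑ j, (C i j - if i = j then 2 else 0) • nodeY j k

theorem modes_nodeY (i : Fin ℓ) (k m : ℤ) :
    modes C (nodeY i k) m = Spec.zpow (1, k, -k) (-m) • y C i m := by
  rw [nodeY, modes_single, Int.cast_one, one_mul]

theorem prefactor_add (d d' : Mono ℓ) : prefactor C (d + d') = prefactor C d + prefactor C d' :=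
  Finsupp.sum_add_index' (by simp) (by intros; simp only [Int.cast_add, add_mul, map_add])

theorem prefactor_nodeY (i : Fin ℓ) (k : ℤ) :
    prefactor C (nodeY i k) = Polynomial.C (2 * rhoOmega C i) * (Polynomial.X - 1) := by
  rw [prefactor, nodeY, Finsupp.sum_single_index (by simp), Int.cast_one, one_mul]

theorem atNode_nodeY (i j : Fin ℓ) (k : ℤ) :
    atNode i (nodeY j k) = if j = i then Finsupp.single (1, k, -k) 1 else 0 := by
  rw [nodeY, atNode_single]

theorem sum_cartanQT_smul (hS : C.IsSymm) (hC : C.det ≠ 0) {M : Type*} [AddCommGroup M] [Module K M]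
    (A : Fin ℓ → M) (i : Fin ℓ) (m : ℤ) :
    ∑ j, cartanQT C m i j • ∑ l, (cartanQT C m)⁻¹ l j • A l = A i := by
  have h1 := Matrix.nonsing_inv_mul _ (isUnit_det_cartanQT hC m)
  have e : ∀ j, ∑ l, cartanQT C m i l * (cartanQT C m)⁻¹ j l = if j = i then 1 else 0 := by
    intro j
    rw [← Matrix.one_apply, ← h1, Matrix.mul_apply]
    refine Finset.sum_congr rfl fun l _ => ?_
    rw [cartanQT_symm hS m i l, mul_comm]
  simp only [Finset.smul_sum, smul_smul]
  rw [Finset.sum_comm]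
  simp only [← Finset.sum_smul, e, ite_smul, one_smul, zero_smul]
  rw [Finset.sum_ite_eq', if_pos (Finset.mem_univ i)]

theorem smul_sum_cartanQT {M : Type*} [AddCommGroup M] [Module K M] (Y : Fin ℓ → M) (i : Fin ℓ)
    (m : ℤ) (s : K) :
    (s * qpow (expo (-(1 * m)) (1 * m))) • Y i + (s * qpow (expo (-(-1 * m)) (-1 * m))) • Y i +
      ∑ j, (C i j - if i = j then 2 else 0) • s • Y j = s • ∑ j, cartanQT C m i j • Y j := by
  have e : ∀ j ∈ Finset.univ, s • cartanQT C m i j • Y j =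
      (if i = j then (s * qpow (expo (-(1 * m)) (1 * m))) • Y i +
        (s * qpow (expo (-(-1 * m)) (-1 * m))) • Y i else 0) +
      (C i j - if i = j then 2 else 0) • s • Y j := by
    intro j _
    simp only [cartanQT, Matrix.of_apply, ← Int.cast_smul_eq_zsmul K, smul_smul, one_mul,
      neg_mul, neg_neg]
    split_ifs with h
    · subst h
      simp only [← add_smul]
      congr 1
      push_cast
      ring
    · rw [zero_add]
      congr 1
      push_cast
      ring
  rw [Finset.smul_sum, Finset.sum_congr rfl e, Finset.sum_add_distrib, Finset.sum_ite_eq,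
    if_pos (Finset.mem_univ i)]

theorem modes_rootMono (hS : C.IsSymm) (hC : C.det ≠ 0) (i : Fin ℓ) (k m : ℤ) :
    modes C (rootMono C i k) m = Spec.zpow (1, k, -k) (-m) • a C i m := by
  have hz : ∀ r : ℤ, Spec.zpow (1, k + r, -(k + r)) (-m) =
      Spec.zpow (1, k, -k) (-m) * qpow (expo (-(r * m)) (r * m)) := by
    intro r
    simp only [Spec.zpow, mul_assoc, ← qpow_add]
    congr 2
    simp only [expo]
    push_cast
    simp only [map_neg, map_mul, map_add]
    ring
  have hsum := map_sum (AddMonoidHom.mk' (fun d => modes C d m) fun d d' => modes_add d d' m)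
    (fun j => (C i j - if i = j then 2 else 0) • nodeY j k) Finset.univ
  simp only [map_zsmul] at hsum
  simp only [AddMonoidHom.mk'_apply, modes_nodeY] at hsum
  rw [rootMono, modes_add, modes_add, hsum, modes_nodeY, modes_nodeY, sub_eq_add_neg k 1, hz, hz]
  refine (smul_sum_cartanQT (C := C) (fun j => y C j m) i m _).trans ?_
  exact congrArg _ (sum_cartanQT_smul hS hC (fun l => a C l m) i m)

theorem prefactor_rootMono (hC : C.det ≠ 0) (i : Fin ℓ) (k : ℤ) :
    prefactor C (rootMono C i k) = 2 * (Polynomial.X - 1) := by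
  have hsum := map_sum (AddMonoidHom.mk' (prefactor C) prefactor_add)
    (fun j => (C i j - if i = j then 2 else 0) • nodeY j k) Finset.univ
  simp only [map_zsmul] at hsum
  simp only [AddMonoidHom.mk'_apply, prefactor_nodeY] at hsum
  have hρ : ∑ j, (C i j : ℂ) * rhoOmega C j = 1 := by
    have hu : IsUnit (C.map (Int.cast : ℤ → ℂ)).det := by
      have : (C.map (Int.cast : ℤ → ℂ)).det = ((C.det : ℤ) : ℂ) :=
        ((Int.castRingHom ℂ).map_det C).symm
      rw [this, isUnit_iff_ne_zero]
      exact_mod_cast hC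
    simp only [rhoOmega, Finset.mul_sum]
    rw [Finset.sum_comm]
    have e : ∀ l ∈ Finset.univ, ∑ j, (C i j : ℂ) * (C.map (Int.cast : ℤ → ℂ))⁻¹ j l =
        if i = l then 1 else 0 := by
      intro l _
      rw [← Matrix.one_apply, ← Matrix.mul_nonsing_inv _ hu, Matrix.mul_apply]
      rfl
    rw [Finset.sum_congr rfl e]
    simp
  have e2 : ∀ j ∈ Finset.univ, (C i j - if i = j then 2 else 0) •
      (Polynomial.C (2 * rhoOmega C j) * (Polynomial.X - 1) : ℂ[X]) =
      Polynomial.C (2 * (C i j * rhoOmega C j)) * (Polynomial.X - 1) -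
        if i = j then Polynomial.C (4 * rhoOmega C i) * (Polynomial.X - 1) else 0 := by
    intro j _
    rw [zsmul_eq_mul]
    split_ifs with h
    · subst h
      simp only [map_mul, Int.cast_sub, map_intCast, map_ofNat]
      push_cast
      ring
    · simp only [map_mul, Int.cast_sub, map_intCast, map_ofNat]
      push_cast
      ring
  rw [rootMono, prefactor_add, prefactor_add, hsum, prefactor_nodeY, prefactor_nodeY,
    Finset.sum_congr rfl e2, Finset.sum_sub_distrib, ← Finset.sum_mul, ← map_sum, ← Finset.mul_sum,
    hρ, Finset.sum_ite_eq, if_pos (Finset.mem_univ i)]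
  simp only [map_mul, map_ofNat, map_one]
  ring

theorem atNode_rootMono {i : Fin ℓ} (hi : C i i = 2) (k : ℤ) :
    atNode i (rootMono C i k) =
      Finsupp.single (1, k + 1, -(k + 1)) 1 + Finsupp.single (1, k - 1, -(k - 1)) 1 := by
  rw [rootMono, map_add, map_add, map_sum, Finset.sum_eq_zero, add_zero, atNode_nodeY, atNode_nodeY,
    if_pos rfl, if_pos rfl]
  intro j _
  rw [map_zsmul, atNode_nodeY]
  split_ifs with h h' h'
  · rw [← h, hi, sub_self, zero_smul]
  · exact smul_zero _
  · exact absurd h'.symm h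
  · exact smul_zero _

theorem screen_monoField_cancel (hS : C.IsSymm) (hC : C.det ≠ 0) (hc : IsScreening c π π')
    {i : Fin ℓ} (hi : C i i = 2) {d₁ d₂ : Mono ℓ} {k : ℤ}
    (hd₁ : atNode i d₁ = Finsupp.single (1, k, -k) 1) (h : d₁ = d₂ + rootMono C i (k - 1))
    (n : ℤ) (f : Fock ℓ) :
    (screen C i c π (monoField C d₁ n (Finsupp.single 0 f)) -
      monoField C d₁ n (screen C i c π (Finsupp.single 0 f))) +
    (screen C i c π (monoField C d₂ n (Finsupp.single 0 f)) -
      monoField C d₂ n (screen C i c π (Finsupp.single 0 f))) = 0 := by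
  have hd₂ : atNode i d₂ = Finsupp.single (1, k - 2, -(k - 2)) (-1) := by
    have := hd₁
    rw [h, map_add, atNode_rootMono hi, sub_add_cancel, show k - 1 - 1 = k - 2 by ring] at this
    rw [Finsupp.single_neg]
    exact eq_neg_of_add_eq_zero_left (add_right_cancel
      (b := (Finsupp.single (1, k, -k) 1 : Spec →₀ ℤ)) (by
        rw [zero_add, add_assoc, add_comm (Finsupp.single (1, k - 2, -(k - 2)) 1)]; exact this))
  have hP : qUnit ((-1 : ℤ) • π + expo (k - 2) (-(k - 2))) =
      qUnit ((1 : ℤ) • π + expo k (-k)) * qUnit π' ^ (2 : ℤ) := by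
    rw [← qUnit_zsmul, ← qUnit_add]
    congr 1
    simp only [expo, zsmul_eq_mul]
    push_cast
    simp only [map_neg, map_sub, map_ofNat]
    linear_combination -2 * hc.add_eq
  have hs : qUnit (expo (k - 1) (-(k - 1))) = qUnit ((1 : ℤ) • π + expo k (-k)) * qUnit π' := by
    rw [← qUnit_add]
    congr 1
    simp only [expo, zsmul_eq_mul]
    push_cast
    simp only [map_neg, map_sub, map_one]
    linear_combination -hc.add_eq
  obtain ⟨P, hP₁⟩ : ∃ P, P = qUnit ((1 : ℤ) • π + expo k (-k)) := ⟨_, rfl⟩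
  have hmodes : ∀ m, modes C d₁ m + ((P ^ (-m) : K'ˣ) : K') • c m • x C i m =
      modes C d₂ m + (((P * qUnit π' ^ (2 : ℤ)) ^ (-m) : K'ˣ) : K') • c m • x C i m := by
    intro m
    have hsc : ((P ^ (-m) : K'ˣ) : K') * ((qUnit π' ^ (-m) : K'ˣ) : K') *
        algebraMap K K' (cst ((m : ℂ)⁻¹) * (qpow (expo m 0) - qpow (-expo m 0))) +
        ((P ^ (-m) : K'ˣ) : K') * c m = (((P * qUnit π' ^ (2 : ℤ)) ^ (-m) : K'ˣ) : K') * c m := by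
      have h1 := hc.shift m
      have h2 : ((qUnit π' ^ (-m) : K'ˣ) : K') * ((qUnit π' ^ m : K'ˣ) : K') = 1 := by
        rw [← Units.val_mul, ← zpow_add, neg_add_cancel, zpow_zero, Units.val_one]
      rw [mul_zpow, ← zpow_mul, mul_comm 2 (-m), zpow_mul, zpow_ofNat, Units.val_mul,
        Units.val_pow_eq_pow_val]
      linear_combination (((P ^ (-m) : K'ˣ) : K') * ((qUnit π' ^ (-m) : K'ˣ) : K')) * h1 -
        ((P ^ (-m) : K'ˣ) : K') * c m * h2
    have ha : Spec.zpow (1, k - 1, -(k - 1)) (-m) • a C i m =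
        (((P ^ (-m) : K'ˣ) : K') * ((qUnit π' ^ (-m) : K'ˣ) : K') *
        algebraMap K K' (cst ((m : ℂ)⁻¹) * (qpow (expo m 0) - qpow (-expo m 0)))) • x C i m := by
      rw [← Units.val_mul, ← mul_zpow, hP₁, ← hs, ← algebraMap_zpow_spec, mul_smul, algebraMap_smul,
        algebraMap_smul]
      rfl
    rw [h, modes_add, modes_rootMono hS hC, ha, add_assoc, smul_smul, smul_smul, ← add_smul, hsc]
  have hpre : prefactor C d₁ = prefactor C d₂ + (π + π' + (π + π')) := by
    rw [h, prefactor_add, prefactor_rootMono hC, hc.add_eq]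
    ring
  have hcoef : (qUnit (prefactor C d₁) : K') *
      (qUnit ((1 : ℤ) • π + expo k (-k)) - qUnit (-((1 : ℤ) • π) + expo k (-k))) =
      -((qUnit (prefactor C d₂) : K') *
      (qUnit ((-1 : ℤ) • π + expo (k - 2) (-(k - 2))) -
        qUnit (-((-1 : ℤ) • π) + expo (k - 2) (-(k - 2))))) := by
    have h2 : ∀ e : ℤ, expo (k - 2) (-(k - 2)) = expo k (-k) + (π + π' + (π + π')) := by
      intro e
      rw [hc.add_eq]
      simp only [expo]
      push_cast
      simp only [map_neg, map_sub, map_ofNat]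
      ring
    rw [hpre, h2 0]
    simp only [one_smul, neg_smul, neg_neg, qUnit_add, Units.val_mul, qUnit_neg]
    have := (qUnit π).inv_mul
    linear_combination 0 * this
  rw [screen_monoField hS hC hc i d₁ (by simp) hd₁ rfl rfl,
    screen_monoField hS hC hc i d₂ (by simp) hd₂ rfl rfl]
  rw [hcoef, hP, ← hP₁, funext hmodes, neg_smul, neg_add_cancel]

theorem expo_eq_zsmul_X (m : ℤ) : expo 0 m = m • Polynomial.X := by simp [expo]

theorem expo_eq_zsmul_one (m : ℤ) : expo m 0 = m • 1 := by simp [expo]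

theorem algebraMap_tdiff (m : ℤ) : algebraMap K K' (tdiff m) =
    ((qUnit Polynomial.X ^ m : K'ˣ) : K') - (qUnit Polynomial.X ^ (-m) : K'ˣ) := by
  rw [tdiff, map_sub, val_qUnit_zpow, val_qUnit_zpow, neg_smul, expo_eq_zsmul_X]

theorem algebraMap_qdiff (m : ℤ) : algebraMap K K' (qpow (expo m 0) - qpow (-expo m 0)) =
    ((qUnit (-1) ^ (-m) : K'ˣ) : K') - (qUnit (-1) ^ m : K'ˣ) := by
  rw [map_sub, val_qUnit_zpow, val_qUnit_zpow, expo_eq_zsmul_one, smul_neg, smul_neg, neg_smul,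
    neg_neg]

theorem screenPlus_eq (i : Fin ℓ) : screenPlus C i =
    screen C i (fun m => algebraMap K K' (cst ((m : ℂ)⁻¹))) Polynomial.X := by
  simp only [screenPlus, screen, algebraMap_smul]

theorem screenMinus_eq (i : Fin ℓ) : screenMinus C i =
    screen C i (fun m => -qtRatio m * algebraMap K K' (cst ((m : ℂ)⁻¹))) (-1) := by
  simp only [screenMinus, screen, mul_smul, algebraMap_smul, neg_neg]

theorem isScreening_plus :
    IsScreening (fun m => algebraMap K K' (cst ((m : ℂ)⁻¹))) Polynomial.X (-1) where
  add_eq := by ring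
  contraction m := by
    rcases eq_or_ne m 0 with rfl | hm
    · simp
    · have := congrArg (algebraMap K K') (cst_inv_mul_intCast hm)
      rw [map_mul, map_intCast, map_one] at this
      rw [← algebraMap_tdiff, zsmul_eq_mul]
      linear_combination algebraMap K K' (tdiff m) * this
  shift m := by
    rw [map_mul, algebraMap_qdiff]
    ring

theorem isScreening_minus :
    IsScreening (fun m => -qtRatio m * algebraMap K K' (cst ((m : ℂ)⁻¹))) (-1) Polynomial.X where
  add_eq := by ring
  contraction m := by
    rcases eq_or_ne m 0 with rfl | hm
    · simp
    · have h1 := congrArg (algebraMap K K') (cst_inv_mul_intCast hm)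
      have h2 := qtRatio_mul hm
      rw [map_mul, map_intCast, map_one] at h1
      rw [algebraMap_qdiff] at h2
      rw [zsmul_eq_mul, tdiff]
      linear_combination (-qtRatio m * algebraMap K K' (qpow (expo 0 m) - qpow
          (-expo 0 m))) * h1 - h2
  shift m := by
    rcases eq_or_ne m 0 with rfl | hm
    · simp [cst_zero]
    · have h2 := qtRatio_mul hm
      rw [← algebraMap_tdiff, map_mul, tdiff]
      linear_combination (-algebraMap K K' (cst ((m : ℂ)⁻¹))) * h2

/-- Sums of monomials whose poles cancel in pairs belong to the deformed `W`-algebra. -/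
theorem sum_monoField_mem_WField (hS : C.IsSymm) (hC : C.det ≠ 0) (hdiag : ∀ i, C i i = 2)
    {ι : Type*} (s : Finset ι) (μ : ι → Mono ℓ)
    (H : ∀ (i : Fin ℓ) (D : Mono ℓ → FockSum ℓ), (∀ d, atNode i d = 0 → D d = 0) →
      (∀ d₁ d₂ k, atNode i d₁ = Finsupp.single (1, k, -k) 1 → d₁ = d₂ + rootMono C i (k - 1) →
        D d₁ + D d₂ = 0) → ∑ j ∈ s, D (μ j) = 0) :
    ∑ j ∈ s, monoField C (μ j) ∈ WField C := by
  have hscreen : ∀ i (c : ℤ → K') (π π' : ℂ[X]), IsScreening c π π' →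
      CommutesOnVacuum (∑ j ∈ s, monoField C (μ j)) (screen C i c π) := by
    intro i c π π' hc n f
    have h := H i (fun d => screen C i c π (monoField C d n (Finsupp.single 0 f)) -
      monoField C d n (screen C i c π (Finsupp.single 0 f))) ?_ ?_
    · rw [Finset.sum_sub_distrib, sub_eq_zero, ← map_sum] at h
      rw [Finset.sum_apply, LinearMap.sum_apply, LinearMap.sum_apply, h]
    · intro d hd
      have hd' : atNode i d = Finsupp.single (1, 0, -0) 0 := by rw [hd, Finsupp.single_zero]
      rw [screen_monoField hS hC hc i d (by simp) hd' rfl rfl]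
      simp
    · exact fun d₁ d₂ k h₁ h₂ => screen_monoField_cancel hS hC hc (hdiag i) h₁ h₂ n f
  refine ⟨sum_mem fun j _ => Submodule.subset_span ⟨μ j, rfl⟩, fun i => ⟨?_, ?_⟩⟩
  · rw [screenPlus_eq]
    exact hscreen i _ _ _ isScreening_plus
  · rw [screenMinus_eq]
    exact hscreen i _ _ _ isScreening_minus

end

/-! ### Type `D` -/

/-- The sum of the values of `f` over the neighbours of the node `j` (numbered from `1`) of the
Dynkin diagram `D_ℓ`. -/
def nbrSum (ℓ : ℕ) {M : Type*} [AddCommGroup M] (f : ℕ → M) (j : ℕ) : M :=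
  if j + 2 < ℓ then f (j - 1) + f (j + 1)
  else if j + 2 = ℓ then f (j - 1) + f (ℓ - 1) + f ℓ
  else f (ℓ - 2)

theorem sum_fin_ite {M : Type*} [AddCommGroup M] (f : ℕ → M) (f0 : f 0 = 0) {n : ℕ} (hn : n ≤ ℓ) :
    ∑ j : Fin ℓ, (if (j : ℕ) + 1 = n then f (j + 1) else 0) = f n := by
  rw [Fin.sum_univ_eq_sum_range (fun j => if j + 1 = n then f (j + 1) else 0) ℓ]
  rcases n with _ | n
  · simp [f0]
  · rw [Finset.sum_eq_single_of_mem n (Finset.mem_range.2 hn)]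
    · simp
    · intro j _ hj
      rw [if_neg (by omega)]

theorem sum_D_smul (hℓ : 3 ≤ ℓ) {M : Type*} [AddCommGroup M] (f : ℕ → M) (f0 : f 0 = 0)
    (i : Fin ℓ) :
    ∑ j : Fin ℓ, (CartanMatrix.D ℓ i j - if i = j then 2 else 0) • f (j + 1) =
      -nbrSum ℓ f (i + 1) := by
  have hi := i.2
  rcases lt_trichotomy ((i : ℕ) + 3) ℓ with h | h | h
  · rw [nbrSum, if_pos (by omega), ← sum_fin_ite f f0 (n := i + 1 - 1) (ℓ := ℓ) (by omega),
      ← sum_fin_ite f f0 (n := i + 1 + 1) (ℓ := ℓ) (by omega), ← Finset.sum_add_distrib,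
      ← Finset.sum_neg_distrib]
    refine Finset.sum_congr rfl fun j _ => ?_
    have hj := j.2
    simp only [CartanMatrix.D, Matrix.of_apply, Fin.ext_iff]
    split_ifs <;> first | omega | simp
  · rw [nbrSum, if_neg (by omega), if_pos (by omega),
      ← sum_fin_ite f f0 (n := i + 1 - 1) (ℓ := ℓ) (by omega),
      ← sum_fin_ite f f0 (n := ℓ - 1) (ℓ := ℓ) (by omega),
      ← sum_fin_ite f f0 (n := ℓ) (ℓ := ℓ) (by omega), ← Finset.sum_add_distrib,
      ← Finset.sum_add_distrib, ← Finset.sum_neg_distrib]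
    refine Finset.sum_congr rfl fun j _ => ?_
    have hj := j.2
    simp only [CartanMatrix.D, Matrix.of_apply, Fin.ext_iff]
    split_ifs <;> first | omega | simp
  · rw [nbrSum, if_neg (by omega), if_neg (by omega),
      ← sum_fin_ite f f0 (n := ℓ - 2) (ℓ := ℓ) (by omega), ← Finset.sum_neg_distrib]
    refine Finset.sum_congr rfl fun j _ => ?_
    have hj := j.2
    simp only [CartanMatrix.D, Matrix.of_apply, Fin.ext_iff]
    split_ifs <;> first | omega | simp

theorem det_D_ne_zero (hℓ : 3 ≤ ℓ) : (CartanMatrix.D ℓ).det ≠ 0 := by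
  intro hdet
  obtain ⟨v, hv0, hv⟩ := Matrix.exists_mulVec_eq_zero_iff.2 hdet
  obtain ⟨f, hf⟩ : ∃ f : ℕ → ℤ, f = fun n => if h : 1 ≤ n ∧ n ≤ ℓ then v ⟨n - 1, by omega⟩ else 0 :=
    ⟨_, rfl⟩
  have f0 : f 0 = 0 := by simp [hf]
  have hfv : ∀ j : Fin ℓ, f (j + 1) = v j := by
    intro j
    simp only [hf]
    rw [dif_pos (by omega)]
    rfl
  have heq : ∀ n, 1 ≤ n → n ≤ ℓ → 2 * f n = nbrSum ℓ f n := by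
    intro n h1 h2
    obtain ⟨i, rfl⟩ : ∃ i : Fin ℓ, n = i + 1 := ⟨⟨n - 1, by omega⟩, by simp; omega⟩
    have h3 := sum_D_smul hℓ f f0 i
    have h4 := congrFun hv i
    simp only [Matrix.mulVec, dotProduct, Pi.zero_apply] at h4
    simp only [hfv, smul_eq_mul, sub_mul, Finset.sum_sub_distrib, h4, ite_mul, zero_mul,
      Finset.sum_ite_eq, Finset.mem_univ, if_true] at h3
    rw [hfv]
    linarith
  have hlin : ∀ n, n + 2 ≤ ℓ → f n = n * f 1 ∧ (n + 3 ≤ ℓ → f (n + 1) = (n + 1) * f 1) := by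
    intro n
    induction n with
    | zero => intro _; simp [f0]
    | succ n ih =>
      intro hn
      obtain ⟨h1, h2⟩ := ih (by omega)
      have h2 := h2 (by omega)
      refine ⟨by push_cast; exact h2, fun h3 => ?_⟩
      have h4 := heq (n + 1) (by omega) (by omega)
      rw [nbrSum, if_pos (by omega), Nat.add_sub_cancel, h1, h2] at h4
      push_cast
      linarith
  obtain ⟨L, rfl⟩ : ∃ L, ℓ = L + 3 := ⟨ℓ - 3, by omega⟩
  have e1 := (hlin (L + 1) (by omega)).1
  have e2 := (hlin L (by omega)).1
  have e3 := heq (L + 1) (by omega) (by omega)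
  have e4 := heq (L + 2) (by omega) (by omega)
  have e5 := heq (L + 3) (by omega) (by omega)
  rw [nbrSum, if_neg (by omega), if_pos (by omega), Nat.add_sub_cancel, show L + 3 - 1 =
      L + 2 by omega] at e3
  rw [nbrSum, if_neg (by omega), if_neg (by omega), show L + 3 - 2 = L + 1 by omega] at e4 e5
  push_cast at e1
  have f1 : f 1 = 0 := by linarith
  apply hv0
  funext j
  rw [← hfv, Pi.zero_apply]
  have hj := j.2
  rw [f1, mul_zero] at e1
  by_cases h1 : (j : ℕ) + 1 + 2 ≤ L + 3
  · rw [(hlin _ h1).1, f1, mul_zero]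
  · rcases (by omega : (j : ℕ) + 1 = L + 2 ∨ (j : ℕ) + 1 = L + 3) with h | h <;> rw [h] <;> linarith

theorem Y_succ (i : Fin ℓ) (k : ℤ) : Y ℓ (i + 1) k = nodeY i k := by
  rw [Y, dif_pos (by omega)]
  rfl

theorem Y_zero (k : ℤ) : Y ℓ 0 k = 0 := by simp [Y]

theorem rootMono_D (hℓ : 3 ≤ ℓ) (i : Fin ℓ) (k : ℤ) : rootMono (CartanMatrix.D ℓ) i k =
    Y ℓ (i + 1) (k + 1) + Y ℓ (i + 1) (k - 1) - nbrSum ℓ (fun j => Y ℓ j k) (i + 1) := by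
  rw [sub_eq_add_neg, ← sum_D_smul hℓ (fun j => Y ℓ j k) (Y_zero k)]
  simp only [Y_succ, rootMono]

theorem atNode_Y (i : Fin ℓ) (j : ℕ) (k : ℤ) :
    atNode i (Y ℓ j k) = if j = i + 1 then Finsupp.single (1, k, -k) 1 else 0 := by
  have hi := i.2
  by_cases h : 1 ≤ j ∧ j ≤ ℓ
  · obtain ⟨j, rfl⟩ : ∃ j' : Fin ℓ, j = j' + 1 := ⟨⟨j - 1, by omega⟩, by simp; omega⟩
    rw [Y_succ, atNode_nodeY]
    simp only [Fin.ext_iff, Nat.add_right_cancel_iff]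
  · rw [Y, dif_neg h, map_zero, if_neg (by omega)]

theorem sum_D_mem_WField (hℓ : 3 ≤ ℓ) {ι : Type*} (s : Finset ι) (μ : ι → Mono ℓ)
    (H : ∀ (i : Fin ℓ) (D : Mono ℓ → FockSum ℓ), (∀ d, atNode i d = 0 → D d = 0) →
      (∀ d₁ d₂ k, atNode i d₁ = Finsupp.single (1, k, -k) 1 →
        d₁ + nbrSum ℓ (fun j => Y ℓ j (k - 1)) (i + 1) = d₂ + (Y ℓ (i + 1) k + Y ℓ (i + 1)
            (k - 2)) →
        D d₁ + D d₂ = 0) → ∑ j ∈ s, D (μ j) = 0) :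
    ∑ j ∈ s, monoField (CartanMatrix.D ℓ) (μ j) ∈ WField (CartanMatrix.D ℓ) := by
  refine sum_monoField_mem_WField (CartanMatrix.D_isSymm ℓ) (det_D_ne_zero hℓ)
    (CartanMatrix.D_diag ℓ) s μ fun i D h0 h1 => H i D h0 fun d₁ d₂ k hk h => h1 d₁ d₂ k hk ?_
  rw [rootMono_D hℓ, sub_add_cancel, sub_sub, one_add_one_eq_two, ← add_sub_assoc, ← h,
    add_sub_cancel_right]

/-! ### The vector field -/

theorem vectorField_mem (hℓ : 3 ≤ ℓ) : vectorField ℓ ∈ WField (CartanMatrix.D ℓ) := by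
  have e : vectorField ℓ = ∑ p ∈ Finset.Icc 1 ℓ ×ˢ (Finset.univ : Finset Bool),
      monoField (CartanMatrix.D ℓ) (if p.2 then Lam ℓ p.1 else LamBar ℓ p.1) := by
    rw [Finset.sum_product]
    simp [vectorField]
  rw [e]
  refine sum_D_mem_WField hℓ _ _ fun i D h0 h1 => ?_
  rw [Finset.sum_product]
  simp only [Fintype.sum_bool, if_true, Bool.false_eq_true, if_false]
  have hi := i.2
  obtain ⟨a, ha⟩ : ∃ a : ℕ, a = if (i : ℕ) + 1 = ℓ then ℓ - 1 else i + 1 := ⟨_, rfl⟩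
  have ha2 : 1 ≤ a ∧ a + 1 ≤ ℓ := by split_ifs at ha <;> omega
  rw [← Finset.sum_subset (s₁ := {a, a + 1}), Finset.sum_pair (by omega)]
  · rcases (by omega : (i : ℕ) + 3 < ℓ ∨ (i : ℕ) + 3 = ℓ ∨ (i : ℕ) + 2 = ℓ ∨ (i : ℕ) + 1 = ℓ) with
      h | h | h | h
    · rw [if_neg (by omega)] at ha
      have p1 := h1 (Lam ℓ a) (Lam ℓ (a + 1)) (-a + 1)
        (by
          rw [Lam, if_pos (by omega)]
          simp only [map_sub, atNode_Y]
          rw [if_pos (by omega), if_neg (by omega), sub_zero])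
        (by
          rw [Lam, Lam, nbrSum, if_pos (by omega), if_pos (by omega), if_pos (by omega), ha]
          push_cast
          ring_nf
          abel)
      have p2 := h1 (LamBar ℓ (a + 1)) (LamBar ℓ a) (-2 * ℓ + (a + 1 : ℕ) + 2)
        (by
          rw [LamBar, if_pos (by omega)]
          simp only [map_sub, atNode_Y]
          rw [if_pos (by omega), if_neg (by omega), sub_zero])
        (by
          rw [LamBar, LamBar, nbrSum, if_pos (by omega), if_pos (by omega), if_pos (by omega), ha]
          push_cast
          ring_nf
          abel)
      rw [add_add_add_comm, p1, add_comm (D (LamBar ℓ a)), p2, add_zero]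
    · rw [if_neg (by omega)] at ha
      have p1 := h1 (Lam ℓ a) (Lam ℓ (a + 1)) (-a + 1)
        (by
          rw [Lam, if_pos (by omega)]
          simp only [map_sub, atNode_Y]
          rw [if_pos (by omega), if_neg (by omega), sub_zero])
        (by
          rw [Lam, Lam, nbrSum, if_pos (by omega), if_neg (by omega), if_pos (by omega),
            if_neg (by omega), if_pos (by omega), ha, show ℓ - 2 = (i : ℕ) + 1 by omega,
            show ℓ - 1 = (i : ℕ) + 2 by omega, show (ℓ : ℤ) = i + 3 by omega]
          push_cast
          ring_nf
          abel)
      have p2 := h1 (LamBar ℓ (a + 1)) (LamBar ℓ a) (-ℓ + 1)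
        (by
          rw [LamBar, if_neg (by omega), if_pos (by omega)]
          simp only [map_sub, atNode_Y]
          rw [if_pos (by omega), if_neg (by omega), if_neg (by omega), sub_zero, sub_zero])
        (by
          rw [LamBar, LamBar, nbrSum, if_neg (by omega), if_pos (by omega), if_neg (by omega),
            if_pos (by omega), if_pos (by omega), ha, show ℓ - 2 = (i : ℕ) + 1 by omega,
            show ℓ - 1 = (i : ℕ) + 2 by omega, show (ℓ : ℤ) = i + 3 by omega]
          push_cast
          ring_nf
          abel)
      rw [add_add_add_comm, p1, add_comm (D (LamBar ℓ a)), p2, add_zero]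
    · rw [if_neg (by omega)] at ha
      have p1 := h1 (Lam ℓ a) (Lam ℓ (a + 1)) (-ℓ + 2)
        (by
          rw [Lam, if_neg (by omega), if_pos (by omega)]
          simp only [map_sub, map_add, atNode_Y]
          rw [if_neg (by omega), if_pos (by omega), if_neg (by omega), sub_zero, zero_add])
        (by
          rw [Lam, Lam, nbrSum, if_neg (by omega), if_pos (by omega), if_neg (by omega),
            if_neg (by omega), if_neg (by omega), if_neg (by omega), show ℓ - 1 =
                (i : ℕ) + 1 by omega]
          ring_nf
          abel)
      have p2 := h1 (LamBar ℓ (a + 1)) (LamBar ℓ a) (-ℓ + 2)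
        (by
          rw [LamBar, if_neg (by omega), if_neg (by omega)]
          simp only [map_sub, atNode_Y]
          rw [if_pos (by omega), if_neg (by omega), sub_zero])
        (by
          rw [LamBar, LamBar, nbrSum, if_neg (by omega), if_neg (by omega), if_neg (by omega),
            if_neg (by omega), if_neg (by omega), if_pos (by omega), show ℓ - 1 =
                (i : ℕ) + 1 by omega]
          ring_nf
          abel)
      rw [add_add_add_comm, p1, add_comm (D (LamBar ℓ a)), p2, add_zero]
    · rw [if_pos h] at ha
      have p1 := h1 (Lam ℓ a) (LamBar ℓ (a + 1)) (-ℓ + 2)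
        (by
          rw [Lam, if_neg (by omega), if_pos (by omega)]
          simp only [map_sub, map_add, atNode_Y]
          rw [if_pos (by omega), if_neg (by omega), if_neg (by omega), sub_zero, add_zero])
        (by
          rw [Lam, LamBar, nbrSum, if_neg (by omega), if_pos (by omega), if_neg (by omega),
            if_neg (by omega), if_neg (by omega), if_neg (by omega), h]
          ring_nf
          abel)
      have p2 := h1 (Lam ℓ (a + 1)) (LamBar ℓ a) (-ℓ + 2)
        (by
          rw [Lam, if_neg (by omega), if_neg (by omega)]
          simp only [map_sub, atNode_Y]
          rw [if_pos (by omega), if_neg (by omega), sub_zero])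
        (by
          rw [Lam, LamBar, nbrSum, if_neg (by omega), if_neg (by omega), if_neg (by omega),
            if_neg (by omega), if_neg (by omega), if_pos (by omega), h]
          ring_nf
          abel)
      rw [add_comm (D (Lam ℓ (a + 1))), add_add_add_comm, p1, add_comm (D (LamBar ℓ a)), p2,
        add_zero]
  · intro n hn
    simp at hn ⊢
    omega
  · intro n hn hn'
    simp at hn hn'
    rw [h0, h0, add_zero]
    · rw [LamBar]
      split_ifs <;> simp only [map_sub, atNode_Y] <;> split_ifs at ha ⊢ <;> first | omega | simp
    · rw [Lam]
      split_ifs <;> simp only [map_add, map_sub, atNode_Y] <;> split_ifs at ha ⊢ <;>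
          first | omega | simp

/-! ### The spinor fields -/

/-- The extension of a sign vector by `1`. -/
def extendSign {n : ℕ} (σ : Fin n → ℤˣ) (j : ℕ) : ℤˣ := if h : j < n then σ ⟨j, h⟩ else 1

/-- The factor of `spinMono` at the position `n` (numbered from `0`). -/
def spinFactor (ℓ : ℕ) (ε : ℤˣ) (s : ℕ → ℤˣ) (n : ℕ) : Mono ℓ :=
  b ℓ (ε * ∏ i ∈ Finset.range n, -s i) (s n) (-∑ i ∈ Finset.range n, (s i : ℤ)) (n + 1)

/-- The monomial `spinMono`, for a sign vector given by its extension to `ℕ`. -/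
def spinProd (ℓ : ℕ) (ε : ℤˣ) (s : ℕ → ℤˣ) : Mono ℓ :=
  ∑ n ∈ Finset.range (ℓ - 1), spinFactor ℓ ε s n

@[to_additive]
theorem prod_Iio_extendSign {M : Type*} [CommMonoid M] {n : ℕ} (f : ℤˣ → M) (σ : Fin n → ℤˣ)
    (j : Fin n) :
    ∏ i ∈ Finset.Iio j, f (σ i) = ∏ i ∈ Finset.range j, f (extendSign σ i) := by
  rw [← Nat.Iio_eq_range, ← Fin.map_valEmbedding_Iio, Finset.prod_map]
  refine Finset.prod_congr rfl fun i _ => ?_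
  simp [extendSign]

theorem spinMono_eq (ε : ℤˣ) (σ : Fin (ℓ - 1) → ℤˣ) :
    spinMono ℓ ε σ = spinProd ℓ ε (extendSign σ) := by
  rw [spinProd, ← Fin.sum_univ_eq_sum_range, spinMono]
  refine Finset.sum_congr rfl fun j _ => ?_
  rw [prod_Iio_extendSign (fun s => -s), sum_Iio_extendSign (fun s : ℤˣ => (s : ℤ)), spinFactor]
  simp [extendSign]

@[to_additive]
theorem prod_range_swap {M : Type*} [CommMonoid M] (f : ℕ → M) {a n : ℕ} (hn : n ≠ a + 1) :
    ∏ i ∈ Finset.range n, f (Equiv.swap a (a + 1) i) = ∏ i ∈ Finset.range n, f i := by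
  refine Finset.prod_equiv (Equiv.swap a (a + 1)) (fun i => ?_) fun _ _ => rfl
  simp only [Finset.mem_range, Equiv.swap_apply_def]
  split_ifs <;> omega

theorem spinFactor_swap (ε : ℤˣ) (s : ℕ → ℤˣ) {a n : ℕ} (h1 : n ≠ a) (h2 : n ≠ a + 1) :
    spinFactor ℓ ε (s ∘ Equiv.swap a (a + 1)) n = spinFactor ℓ ε s n := by
  simp only [spinFactor, Function.comp_apply]
  rw [prod_range_swap (fun i => -s i) h2, sum_range_swap (fun i => (s i : ℤ)) h2,
    Equiv.swap_apply_of_ne_of_ne h1 h2]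

theorem spinNode_ge (ε : ℤˣ) : ℓ - 1 ≤ spinNode ℓ ε := by
  rw [spinNode]
  split_ifs <;> omega

theorem atNode_spinFactor (ε : ℤˣ) (s : ℕ → ℤˣ) {i : Fin ℓ} {n : ℕ} (h1 : n ≠ i)
    (h2 : n ≠ i + 1) (h3 : n + 2 < ℓ ∨ (i : ℕ) + 2 < ℓ) (h4 : n + 1 < ℓ) :
    atNode i (spinFactor ℓ ε s n) = 0 := by
  rw [spinFactor, b]
  generalize ε * ∏ i ∈ Finset.range n, -s i = e
  have := spinNode_ge (ℓ := ℓ) e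
  split_ifs <;> simp only [map_sub, map_neg, map_zero, atNode_Y] <;>
    (repeat rw [if_neg (by omega)]) <;> simp

/-- The part of `spinProd` outside of the positions `a` and `a + 1`. -/
theorem exists_spinProd_eq (ε : ℤˣ) (s : ℕ → ℤˣ) {i : Fin ℓ} (hi : (i : ℕ) + 2 < ℓ) :
    ∃ r : Mono ℓ, atNode i r = 0 ∧
      spinProd ℓ ε s = r + (spinFactor ℓ ε s i + spinFactor ℓ ε s (i + 1)) ∧
      spinProd ℓ ε (s ∘ Equiv.swap (i : ℕ) (i + 1)) =
        r + (spinFactor ℓ ε (s ∘ Equiv.swap (i : ℕ) (i + 1)) i +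
          spinFactor ℓ ε (s ∘ Equiv.swap (i : ℕ) (i + 1)) (i + 1)) := by
  have hsub : ({(i : ℕ), (i : ℕ) + 1} : Finset ℕ) ⊆ Finset.range (ℓ - 1) := by
    intro n hn
    simp at hn ⊢
    omega
  refine ⟨∑ n ∈ Finset.range (ℓ - 1) \ {(i : ℕ), (i : ℕ) + 1}, spinFactor ℓ ε s n, ?_, ?_, ?_⟩
  · rw [map_sum]
    refine Finset.sum_eq_zero fun n hn => ?_
    simp at hn
    exact atNode_spinFactor ε s (by omega) (by omega) (by omega) (by omega)
  · rw [spinProd, ← Finset.sum_sdiff hsub, Finset.sum_pair (by omega)]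
  · rw [spinProd, ← Finset.sum_sdiff hsub, Finset.sum_pair (by omega)]
    congr 1
    refine Finset.sum_congr rfl fun n hn => ?_
    simp at hn
    exact spinFactor_swap ε s (by omega) (by omega)

theorem swap_add_eq_zero (ε : ℤˣ) (s : ℕ → ℤˣ) {i : Fin ℓ} {D : Mono ℓ → FockSum ℓ}
    (h1 : ∀ d₁ d₂ k, atNode i d₁ = Finsupp.single (1, k, -k) 1 →
      d₁ + nbrSum ℓ (fun j => Y ℓ j (k - 1)) (i + 1) = d₂ + (Y ℓ (i + 1) k + Y ℓ (i + 1) (k - 2)) →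
        D d₁ + D d₂ = 0)
    (hi : (i : ℕ) + 2 < ℓ) (hs : s i = -1) (hs' : s (i + 1) = 1) :
    D (spinProd ℓ ε s) + D (spinProd ℓ ε (s ∘ Equiv.swap (i : ℕ) (i + 1))) = 0 := by
  obtain ⟨r, hr, e1, e2⟩ := exists_spinProd_eq ε s hi
  have hp := prod_range_swap (fun n => -s n) (a := i) (n := i) (by omega)
  have hq := sum_range_swap (fun n => (s n : ℤ)) (a := i) (n := i) (by omega)
  rw [e1, e2]
  simp only [spinFactor, Finset.prod_range_succ, Finset.sum_range_succ, Function.comp_apply,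
    Equiv.swap_apply_left, Equiv.swap_apply_right, hp, hq, hs, hs']
  obtain ⟨K, hK⟩ : ∃ K, K = -∑ n ∈ Finset.range i, (s n : ℤ) := ⟨_, rfl⟩
  rw [neg_add, neg_add, ← hK]
  have hne : (-1 : ℤˣ) ≠ 1 := by decide
  rcases (by omega : (i : ℕ) + 3 = ℓ ∨ (i : ℕ) + 3 < ℓ) with h | h
  · have e' : ε * ((∏ n ∈ Finset.range i, -s n) * -1) = -(ε * ∏ n ∈ Finset.range i, -s n) := by
      simp
    rw [neg_neg, mul_one, e']
    generalize ε * _ = e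
    refine h1 _ _ (K - ℓ + 2) ?_ ?_
    · have h5 := spinNode_ge (ℓ := ℓ) e
      simp only [b, if_neg hne, if_true]
      rw [if_neg (by omega), if_pos (by omega)]
      simp only [map_add, map_sub, map_neg, atNode_Y, hr, if_true]
      rw [if_neg (by omega), if_neg (by omega)]
      simp
    · simp only [b, if_neg hne, if_true, nbrSum]
      rw [if_neg (by omega), if_pos (by omega), if_neg (by omega), if_pos (by omega),
        if_neg (by omega), if_pos (by omega), Nat.add_sub_cancel, show ℓ - 2 = (i : ℕ) + 1 by omega]
      push_cast
      rcases Int.units_eq_one_or e with rfl | rfl <;>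
        simp only [spinNode, neg_neg, if_true, if_neg hne] <;> ring_nf <;> abel
  · refine h1 _ _ (K - ℓ + 2) ?_ ?_
    · simp only [b, if_neg hne, if_true]
      rw [if_neg (by omega), if_neg (by omega)]
      simp only [map_add, map_sub, map_zero, atNode_Y, hr, if_true]
      rw [if_neg (by omega)]
      simp
    · simp only [b, if_neg hne, if_true, nbrSum]
      rw [if_neg (by omega), if_neg (by omega), if_pos (by omega), if_neg (by omega),
        if_neg (by omega), Nat.add_sub_cancel, Nat.add_sub_cancel]
      push_cast
      ring_nf
      abel

theorem spinProd_add_swap (ε : ℤˣ) (s : ℕ → ℤˣ) {i : Fin ℓ} {D : Mono ℓ → FockSum ℓ}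
    (h0 : ∀ d, atNode i d = 0 → D d = 0)
    (h1 : ∀ d₁ d₂ k, atNode i d₁ = Finsupp.single (1, k, -k) 1 →
      d₁ + nbrSum ℓ (fun j => Y ℓ j (k - 1)) (i + 1) = d₂ + (Y ℓ (i + 1) k + Y ℓ (i + 1) (k - 2)) →
        D d₁ + D d₂ = 0)
    (hi : (i : ℕ) + 2 < ℓ) :
    D (spinProd ℓ ε s) + D (spinProd ℓ ε (s ∘ Equiv.swap (i : ℕ) (i + 1))) = 0 := by
  have hne : (-1 : ℤˣ) ≠ 1 := by decide
  have key : ∀ u : ℤˣ, s i = u → s (i + 1) = u →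
      D (spinProd ℓ ε s) + D (spinProd ℓ ε (s ∘ Equiv.swap (i : ℕ) (i + 1))) = 0 := by
    intro u hs hs'
    have e : s ∘ Equiv.swap (i : ℕ) (i + 1) = s := by
      funext n
      rw [Function.comp_apply, Equiv.swap_apply_def]
      split_ifs with h h <;> simp [h, hs, hs']
    obtain ⟨r, hr, e1, -⟩ := exists_spinProd_eq ε s hi
    rw [e, h0, add_zero]
    rw [e1, map_add, hr, zero_add]
    simp only [spinFactor, Finset.sum_range_succ, hs, hs']
    have h5 := spinNode_ge (ℓ := ℓ) (ε * ∏ n ∈ Finset.range (i + 1), -s n)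
    rcases Int.units_eq_one_or u with rfl | rfl
    · simp only [b, if_true]
      rw [if_neg (by omega), zero_add]
      split_ifs
      · rw [map_neg, atNode_Y, if_neg (by omega), neg_zero]
      · rw [map_zero]
    · simp only [b, if_neg hne]
      rw [if_neg (by omega)]
      simp only [apply_ite (atNode i), map_add, map_sub, atNode_Y, if_true]
      split_ifs <;> first | omega | skip
      all_goals
        push_cast
        simp
        ring_nf
        simp
  rcases Int.units_eq_one_or (s i) with hs | hs <;>
    rcases Int.units_eq_one_or (s (i + 1)) with hs' | hs'
  · exact key 1 hs hs'
  · have h2 := swap_add_eq_zero ε (s ∘ Equiv.swap (i : ℕ) (i + 1)) h1 hi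
      (by rwa [Function.comp_apply, Equiv.swap_apply_left])
      (by rwa [Function.comp_apply, Equiv.swap_apply_right])
    rw [Function.comp_assoc, ← Equiv.coe_trans, Equiv.swap_swap] at h2
    rw [add_comm]
    exact h2
  · exact swap_add_eq_zero ε s h1 hi hs hs'
  · exact key (-1) hs hs'

theorem spinProd_add_flip (hℓ : 3 ≤ ℓ) (ε : ℤˣ) (s s' : ℕ → ℤˣ) {i : Fin ℓ}
    {D : Mono ℓ → FockSum ℓ}
    (h0 : ∀ d, atNode i d = 0 → D d = 0)
    (h1 : ∀ d₁ d₂ k, atNode i d₁ = Finsupp.single (1, k, -k) 1 →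
      d₁ + nbrSum ℓ (fun j => Y ℓ j (k - 1)) (i + 1) = d₂ + (Y ℓ (i + 1) k + Y ℓ (i + 1) (k - 2)) →
        D d₁ + D d₂ = 0)
    (hi : ℓ ≤ i + 2) (hs : ∀ n < ℓ - 2, s' n = s n) (h : s (ℓ - 2) = -1) (h' : s' (ℓ - 2) = 1) :
    D (spinProd ℓ ε s) + D (spinProd ℓ ε s') = 0 := by
  have hne : (-1 : ℤˣ) ≠ 1 := by decide
  have hp : ∀ m ≤ ℓ - 2, ∏ n ∈ Finset.range m, -s' n = ∏ n ∈ Finset.range m, -s n :=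
    fun m hm => Finset.prod_congr rfl fun n hn => by
      rw [hs n ((Finset.mem_range.1 hn).trans_le hm)]
  have hq : ∀ m ≤ ℓ - 2, ∑ n ∈ Finset.range m, (s' n : ℤ) = ∑ n ∈ Finset.range m, (s n : ℤ) :=
    fun m hm => Finset.sum_congr rfl fun n hn => by
      rw [hs n ((Finset.mem_range.1 hn).trans_le hm)]
  have hr : atNode i (∑ n ∈ Finset.range (ℓ - 2), spinFactor ℓ ε s n) = 0 := by
    rw [map_sum]
    refine Finset.sum_eq_zero fun n hn => ?_
    have := Finset.mem_range.1 hn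
    exact atNode_spinFactor ε s (by omega) (by omega) (by omega) (by omega)
  have hr' : ∑ n ∈ Finset.range (ℓ - 2), spinFactor ℓ ε s' n =
      ∑ n ∈ Finset.range (ℓ - 2), spinFactor ℓ ε s n := by
    refine Finset.sum_congr rfl fun n hn => ?_
    have hn := Finset.mem_range.1 hn
    rw [spinFactor, spinFactor, hs n hn, hp n hn.le, hq n hn.le]
  rw [spinProd, spinProd, show ℓ - 1 = ℓ - 2 + 1 by omega, Finset.sum_range_succ,
    Finset.sum_range_succ, hr', spinFactor, spinFactor, hp _ le_rfl, hq _ le_rfl, h, h']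
  generalize ∑ n ∈ Finset.range (ℓ - 2), spinFactor ℓ ε s n = r at *
  generalize -∑ n ∈ Finset.range (ℓ - 2), (s n : ℤ) = K
  generalize ε * _ = e
  have h5 := spinNode_ge (ℓ := ℓ) e
  have hi' := i.2
  simp only [b, if_neg hne, if_true]
  rw [if_pos (by omega), if_pos (by omega)]
  by_cases hJ : spinNode ℓ e = i + 1
  · refine h1 _ _ (K - ℓ + 2) ?_ ?_
    · rw [map_add, map_sub, hr, atNode_Y, atNode_Y, if_pos hJ, if_neg (by omega), sub_zero,
        zero_add]
    · rw [nbrSum, if_neg (by omega), if_neg (by omega), hJ]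
      ring_nf
      abel
  · rw [h0, h0, add_zero]
    · rw [map_add, map_neg, hr, atNode_Y, if_neg hJ, neg_zero, add_zero]
    · rw [map_add, map_sub, hr, atNode_Y, atNode_Y, if_neg hJ, if_neg (by omega), sub_zero,
        add_zero]

theorem sum_eq_zero_of_involution {α M : Type*} [Fintype α] [AddCommGroup M] [IsAddTorsionFree M]
    (e : α ≃ α) (F : α → M) (h : ∀ x, F x + F (e x) = 0) : ∑ x, F x = 0 := by
  have h2 : (∑ x, F x) + ∑ x, F (e x) = 0 := by
    rw [← Finset.sum_add_distrib]
    exact Finset.sum_eq_zero fun x _ => h x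
  rw [Equiv.sum_comp e, ← two_nsmul] at h2
  exact (nsmul_eq_zero_iff_right two_ne_zero).1 h2

theorem spinField_mem (hℓ : 3 ≤ ℓ) (ε : ℤˣ) : spinField ℓ ε ∈ WField (CartanMatrix.D ℓ) := by
  refine sum_D_mem_WField hℓ Finset.univ (spinMono ℓ ε) fun i D h0 h1 => ?_
  have := isAddTorsionFree_of_module (FockSum ℓ)
  simp only [spinMono_eq]
  rcases lt_or_ge ((i : ℕ) + 2) ℓ with hi | hi
  · obtain ⟨x, hx⟩ : ∃ x : Fin (ℓ - 1), (x : ℕ) = i := ⟨⟨i, by omega⟩, rfl⟩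
    obtain ⟨x', hx'⟩ : ∃ x : Fin (ℓ - 1), (x : ℕ) = i + 1 := ⟨⟨i + 1, by omega⟩, rfl⟩
    refine sum_eq_zero_of_involution ((Equiv.swap x x').arrowCongr (Equiv.refl ℤˣ)) _ fun σ => ?_
    rw [← spinProd_add_swap ε (extendSign σ) h0 h1 hi]
    congr 3
    funext n
    simp only [extendSign, Function.comp_apply, Equiv.arrowCongr_apply, Equiv.symm_swap,
      Equiv.coe_refl, id]
    by_cases hn : n < ℓ - 1
    · have hm : Equiv.swap (i : ℕ) (i + 1) n = Equiv.swap x x' ⟨n, hn⟩ := by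
        simp only [Equiv.swap_apply_def, Fin.ext_iff, hx, hx']
        split_ifs <;> simp [hx, hx']
      simp [hm, hn]
    · rw [Equiv.swap_apply_of_ne_of_ne (by omega) (by omega), dif_neg hn, dif_neg hn]
  · obtain ⟨x, hx⟩ : ∃ x : Fin (ℓ - 1), (x : ℕ) = ℓ - 2 := ⟨⟨ℓ - 2, by omega⟩, rfl⟩
    have hlast : ∀ σ : Fin (ℓ - 1) → ℤˣ, extendSign σ (ℓ - 2) = σ x := fun σ => by
      rw [extendSign, dif_pos (by omega)]
      exact congrArg σ (Fin.ext hx.symm)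
    have hrest : ∀ σ : Fin (ℓ - 1) → ℤˣ, ∀ n < ℓ - 2,
        extendSign (σ * Pi.mulSingle x (-1)) n = extendSign σ n := fun σ n hn => by
      rw [extendSign, extendSign, dif_pos (by omega), dif_pos (by omega), Pi.mul_apply,
        Pi.mulSingle_eq_of_ne, mul_one]
      exact fun h => by simp [Fin.ext_iff] at h; omega
    refine sum_eq_zero_of_involution (Equiv.mulRight (Pi.mulSingle x (-1))) _ fun σ => ?_
    simp only [Equiv.coe_mulRight]
    have hx2 : (σ * Pi.mulSingle x (-1) : Fin (ℓ - 1) → ℤˣ) x = -σ x := by simp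
    rcases Int.units_eq_one_or (σ x) with h | h
    · rw [add_comm]
      refine spinProd_add_flip hℓ ε _ _ h0 h1 hi (fun n hn => (hrest σ n hn).symm) ?_ ?_ <;>
        rw [hlast] <;> simp [h]
    · refine spinProd_add_flip hℓ ε _ _ h0 h1 hi (hrest σ) ?_ ?_ <;> rw [hlast] <;> simp [h]

end

end DeformedW

theorem mainTheorem5 (ℓ : ℕ) (hℓ : 3 ≤ ℓ) (i : ℕ) (hi : i = 1 ∨ i = ℓ - 1 ∨ i = ℓ) :
    DeformedW.T ℓ i ∈ DeformedW.WField (CartanMatrix.D ℓ) := by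
  rw [DeformedW.T]
  split_ifs
  · exact DeformedW.vectorField_mem hℓ
  · exact DeformedW.spinField_mem hℓ 1
  · exact DeformedW.spinField_mem hℓ (-1)
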